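/- Let $A\subset\mathbb{R}^d$ be a finite point set that affinely spans $\mathbb{R}^d$. A \emph{polyhedral subdivision} of $A$ is a collection $T$ of affinely spanning subsets of $A$ such that (i) for all $\sigma,\sigma'\in T$ the set $\operatorname{conv}(\sigma)\cap\operatorname{conv}(\sigma')$ is a (possibly empty, possibly improper) face of both $\operatorname{conv}(\sigma)$ and $\operatorname{conv}(\sigma')$, and $\operatorname{conv}(\sigma\cap\sigma')\cap\sigma=\operatorname{conv}(\sigma\cap\sigma')\cap\sigma'$; and (ii) $\bigcup_{\sigma\in T}\operatorname{conv}(\sigma)=\operatorname{conv}(A)$. A subdivision $S$ \emph{refines} $S'$ if every $\sigma\in S$ is contained in some $\sigma'\in S'$. The \emph{Baues poset} of $A$ is the set of all polyhedral subdivisions of $A$ other than the trivial subdivision $\{A\}$, ordered by refinement. A poset is \emph{connected} if any two of its elements are joined by a finite sequence of elements in which consecutive ones are comparable (equivalently, for a nonempty poset, if its order complex is connected). Corollary. There is a set $A$ of at most $17$ points affinely spanning $\mathbb{R}^6$, with at least $9=6+3$ points, whose Baues poset is not connected. (Every set of $8=6+2$ points affinely spanning $\mathbb{R}^6$ has exactly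 two proper subdivisions, and they are incomparable; the lower bound on the number of points excludes this trivial case.) -/

import Mathlib

/-- `T` is a polyhedral subdivision of the finite point set `A`: a collection of affinely spanning
subsets of `A` (the cells) whose convex hulls meet face to face and cover `conv A`. A cell is a set
of points and not just a polytope, so two cells also have to agree on which points of `A` they
contain in their common face. Faces of a polytope are its exposed faces, with the empty face and
the polytope itself included. -/
structure IsPolyhedralSubdivision {E : Type*} [NormedAddCommGroup E] [NormedSpace ℝ E]
    (A : Finset E) (T : Finset (Finset E)) : Prop where
  subset : ∀ σ ∈ T, σ ⊆ A
  spanning : ∀ σ ∈ T, affineSpan ℝ (σ : Set E) = ⊤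
  face : ∀ σ ∈ T, ∀ σ' ∈ T,
    IsExposed ℝ (convexHull ℝ (σ : Set E))
      (convexHull ℝ (σ : Set E) ∩ convexHull ℝ (σ' : Set E)) ∧
    IsExposed ℝ (convexHull ℝ (σ' : Set E))
      (convexHull ℝ (σ : Set E) ∩ convexHull ℝ (σ' : Set E))
  agree : ∀ σ ∈ T, ∀ σ' ∈ T,
    convexHull ℝ ((σ : Set E) ∩ (σ' : Set E)) ∩ (σ : Set E) =
      convexHull ℝ ((σ : Set E) ∩ (σ' : Set E)) ∩ (σ' : Set E)
  cover : (⋃ σ ∈ T, convexHull ℝ (σ : Set E)) = convexHull ℝ (A : Set E)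

/-- `S` refines `S'`: every cell of `S` is contained in a cell of `S'`. -/
def Refines {E : Type*} (S S' : Finset (Finset E)) : Prop :=
  ∀ σ ∈ S, ∃ σ' ∈ S', σ ⊆ σ'

/-- A cell of a subdivision that is contained in another cell is equal to it. -/
theorem IsPolyhedralSubdivision.eq_of_subset {E : Type*} [NormedAddCommGroup E] [NormedSpace ℝ E]
    {A : Finset E} {T : Finset (Finset E)} (hT : IsPolyhedralSubdivision A T)
    {σ τ : Finset E} (hσ : σ ∈ T) (hτ : τ ∈ T) (h : σ ⊆ τ) : σ = τ := by
  have hsub : (σ : Set E) ⊆ (τ : Set E) := by exact_mod_cast h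
  have hne : (σ : Set E).Nonempty := by
    rw [← affineSpan_nonempty ℝ, hT.spanning σ hσ]
    exact ⟨0, trivial⟩
  obtain ⟨x₀, hx₀⟩ := hne
  have hinter : convexHull ℝ (σ : Set E) ∩ convexHull ℝ (τ : Set E) = convexHull ℝ (σ : Set E) :=
    Set.inter_eq_left.2 (convexHull_mono hsub)
  have hface := (hT.face σ hσ τ hτ).2
  rw [hinter] at hface
  obtain ⟨l, hl⟩ := hface ⟨x₀, subset_convexHull ℝ _ hx₀⟩
  have hmax : ∀ x ∈ (σ : Set E), ∀ y ∈ convexHull ℝ (τ : Set E), l y ≤ l x := by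
    intro x hx
    have hx' := subset_convexHull ℝ _ hx
    rw [hl] at hx'
    exact hx'.2
  -- the functional is constant on `σ`, hence everywhere
  have hconst : ∀ y : E, l y = l x₀ := by
    intro y
    have hy : y ∈ affineSpan ℝ (σ : Set E) := by
      rw [hT.spanning σ hσ]; trivial
    refine affineSpan_induction (p := fun z => l z = l x₀) hy ?_ ?_
    · intro x hx
      exact le_antisymm (hmax x₀ hx₀ x (subset_convexHull ℝ _ (hsub hx)))
        (hmax x hx x₀ (subset_convexHull ℝ _ (hsub hx₀)))
    · intro c u v w hu hv hw
      simp only [vsub_eq_sub, vadd_eq_add, map_add, map_smul, map_sub, hu, hv, hw]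
      simp
  have hhull : (τ : Set E) ⊆ convexHull ℝ (σ : Set E) := by
    intro y hy
    rw [hl]
    exact ⟨subset_convexHull ℝ _ hy, fun z _ => by rw [hconst z, hconst y]⟩
  have hagree := hT.agree σ hσ τ hτ
  rw [Set.inter_eq_left.2 hsub, Set.inter_eq_right.2 hhull,
    Set.inter_eq_right.2 (subset_convexHull ℝ _)] at hagree
  exact_mod_cast hagree

theorem IsPolyhedralSubdivision.subset_of_refines {E : Type*} [NormedAddCommGroup E]
    [NormedSpace ℝ E] {A : Finset E} {S S' : Finset (Finset E)}
    (hS : IsPolyhedralSubdivision A S) (h : Refines S S') (h' : Refines S' S) : S ⊆ S' := by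
  intro σ hσ
  obtain ⟨τ, hτ, hστ⟩ := h σ hσ
  obtain ⟨ρ, hρ, hτρ⟩ := h' τ hτ
  have hσρ := hS.eq_of_subset hσ hρ (hστ.trans hτρ)
  subst hσρ
  rw [Finset.Subset.antisymm hστ hτρ]
  exact hτ

/-- The Baues poset of `A`: the polyhedral subdivisions of `A` other than the trivial subdivision
`{A}`, ordered by refinement. -/
def BauesPoset {E : Type*} [NormedAddCommGroup E] [NormedSpace ℝ E] (A : Finset E) : Type _ :=
  {T : Finset (Finset E) // IsPolyhedralSubdivision A T ∧ T ≠ {A}}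

instance {E : Type*} [NormedAddCommGroup E] [NormedSpace ℝ E] (A : Finset E) :
    PartialOrder (BauesPoset A) where
  le S S' := Refines S.1 S'.1
  le_refl S := fun σ hσ => ⟨σ, hσ, Finset.Subset.refl σ⟩
  le_trans S S' S'' h h' := fun σ hσ => by
    obtain ⟨τ, hτ, hστ⟩ := h σ hσ
    obtain ⟨ρ, hρ, hτρ⟩ := h' τ hτ
    exact ⟨ρ, hρ, hστ.trans hτρ⟩
  le_antisymm S S' h h' := Subtype.ext (Finset.Subset.antisymm
    (S.2.1.subset_of_refines h h') (S'.2.1.subset_of_refines h' h))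

/-- The comparability graph of a poset, which is the 1-skeleton of its order complex: two distinct
elements are adjacent if one of them is below the other. -/
def comparabilityGraph (P : Type*) [PartialOrder P] : SimpleGraph P :=
  SimpleGraph.fromRel (fun a b : P => a ≤ b)

/-! The obstruction to connectedness is a set `R` of simplices that survives every move in the
poset. A refinement keeps each simplicial cell, because a simplex has no proper affinely spanning
subset of vertices (`mem_of_refines`). A coarsening keeps `R` if `R` is rigid. If a coarser cell `c`
contains `G ∈ R` and a point beyond a facet that `G` shares with `H ∈ R`, then `c` meets the
interior of `H`, so `c` contains `H` (`mem_of_beyond`). Rigidity says that this propagation, started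
at a member of `R` and one further point, fills all of `A`; the coarsening is then trivial. So
containing `R` is constant on components. The subdivision `{A \ {o}}`, where `o` lies in the hull of
the other points and is a vertex of a member of `R`, does not contain `R`, while a suitable
triangulation does (`not_preconnected_of_isRigid`).

In the example `o` is the origin. The first eight points carry a cyclic band of eight triangles, in
which consecutive triangles share an edge, and so do the next eight. The 64 rigid cells consist of
`o`, a triangle of the first band and a triangle of the second. Rigidity is a finite deduction from
sign conditions.

It remains to see that the given list of simplices is a triangulation. Only local conditions are
checked: each facet is on the boundary or has a cell on its other side, no two cells lie on the same
side of a common facet, and some point is covered exactly once. Following generic segments from cell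
to cell turns this into a global statement: interiors are disjoint, the cells cover `conv A`, and
they meet in common faces (`IsPseudoManifold.isPolyhedralSubdivision`). -/

open Set Filter Topology

/-- `σ` is the vertex set of a full-dimensional simplex. -/
def IsSimplexCell {E : Type*} [NormedAddCommGroup E] [NormedSpace ℝ E] (σ : Finset E) : Prop :=
  AffineIndependent ℝ ((↑) : σ → E) ∧ affineSpan ℝ (σ : Set E) = ⊤

/-! ### Barycentric coordinates as affine functions on the whole space -/

section Barycentric

variable {E : Type*} [NormedAddCommGroup E] [NormedSpace ℝ E]

/-- The total weight is left free: total `1` gives `affine_sum_smul`, and total `0` gives affine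
independence in `of_dual`. -/
theorem sum_mul_affine {ι : Type*} (s : Finset ι) (w : ι → ℝ) (p : ι → E) (f : E →ᵃ[ℝ] ℝ) :
    ∑ i ∈ s, w i * f (p i) = f.linear (∑ i ∈ s, w i • p i) + (∑ i ∈ s, w i) * f 0 := by
  have hf : ∀ y, f y = f.linear y + f 0 := fun y => congrFun f.decomp y
  simp_rw [hf (p _), mul_add, Finset.sum_add_distrib, ← Finset.sum_mul]
  simp

theorem affine_sum_smul {ι : Type*} (s : Finset ι) (w : ι → ℝ) (p : ι → E) (f : E →ᵃ[ℝ] ℝ)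
    (hw : ∑ i ∈ s, w i = 1) : f (∑ i ∈ s, w i • p i) = ∑ i ∈ s, w i * f (p i) := by
  rw [sum_mul_affine, hw, one_mul]
  exact congrFun f.decomp _

theorem affine_sum_apply {ι : Type*} (s : Finset ι) (f : ι → E →ᵃ[ℝ] ℝ) (x : E) :
    (∑ i ∈ s, f i) x = ∑ i ∈ s, f i x := by
  classical
  induction s using Finset.induction_on with
  | empty => simp
  | insert i s hi ih => simp [Finset.sum_insert hi, ih]

/-- The affine basis formed by the vertices of a simplex. -/
noncomputable def IsSimplexCell.basis {σ : Finset E} (h : IsSimplexCell σ) : AffineBasis σ ℝ E where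
  toFun := (↑)
  ind' := h.1
  tot' := by rw [Subtype.range_coe_subtype]; exact h.2

open Classical in
/-- The barycentric coordinate of a point with respect to the vertex `v` of the simplex `σ`. -/
noncomputable def bary (σ : Finset E) (v : E) : E →ᵃ[ℝ] ℝ :=
  if h : IsSimplexCell σ ∧ v ∈ σ then h.1.basis.coord ⟨v, h.2⟩ else 0

namespace IsSimplexCell

variable {σ τ : Finset E} (h : IsSimplexCell σ)
include h

theorem bary_eq {v : E} (hv : v ∈ σ) : bary σ v = h.basis.coord ⟨v, hv⟩ := by
  simp [bary, h, hv]

theorem bary_self {v : E} (hv : v ∈ σ) : bary σ v v = 1 := by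
  rw [h.bary_eq hv]
  exact h.basis.coord_apply_eq ⟨v, hv⟩

theorem bary_of_ne {u v : E} (hu : u ∈ σ) (hv : v ∈ σ) (huv : u ≠ v) : bary σ v u = 0 := by
  rw [h.bary_eq hv]
  exact h.basis.coord_apply_ne (i := ⟨v, hv⟩) (j := ⟨u, hu⟩) (by simpa using huv.symm)

theorem sum_bary (x : E) : ∑ v ∈ σ, bary σ v x = 1 := by
  rw [← Finset.sum_coe_sort, ← h.basis.sum_coord_apply_eq_one x]
  exact Finset.sum_congr rfl fun v _ => by rw [h.bary_eq v.2]

theorem sum_bary_smul (x : E) : ∑ v ∈ σ, bary σ v x • v = x := by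
  rw [← Finset.sum_coe_sort]
  conv_rhs => rw [← h.basis.linear_combination_coord_eq_self x]
  exact Finset.sum_congr rfl fun v _ => by rw [h.bary_eq v.2]; rfl

theorem affine_eq_sum (f : E →ᵃ[ℝ] ℝ) (x : E) : f x = ∑ v ∈ σ, bary σ v x * f v := by
  conv_lhs => rw [← h.sum_bary_smul x]
  exact affine_sum_smul σ _ _ f (h.sum_bary x)

theorem affine_eq_mul {f : E →ᵃ[ℝ] ℝ} {v : E} (hv : v ∈ σ) (hf : ∀ u ∈ σ, u ≠ v → f u = 0)
    (x : E) : f x = bary σ v x * f v := by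
  rw [h.affine_eq_sum f x]
  exact Finset.sum_eq_single_of_mem v hv fun u hu huv => by rw [hf u hu huv, mul_zero]

theorem mem_convexHull {x : E} : x ∈ convexHull ℝ (σ : Set E) ↔ ∀ v ∈ σ, 0 ≤ bary σ v x := by
  have hr : range h.basis = (σ : Set E) := by
    change range ((↑) : σ → E) = _
    simp
  have := h.basis.convexHull_eq_nonneg_coord
  rw [hr] at this
  rw [this]
  constructor
  · intro hx v hv
    rw [h.bary_eq hv]
    exact hx ⟨v, hv⟩
  · intro hx v
    rw [← h.bary_eq v.2]
    exact hx v v.2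

theorem mem_interior {x : E} :
    x ∈ interior (convexHull ℝ (σ : Set E)) ↔ ∀ v ∈ σ, 0 < bary σ v x := by
  have hr : range h.basis = (σ : Set E) := by
    change range ((↑) : σ → E) = _
    simp
  have := h.basis.interior_convexHull
  rw [hr] at this
  rw [this]
  constructor
  · intro hx v hv
    rw [h.bary_eq hv]
    exact hx ⟨v, hv⟩
  · intro hx v
    rw [← h.bary_eq v.2]
    exact hx v v.2

theorem interior_nonempty : (interior (convexHull ℝ (σ : Set E))).Nonempty := by
  have hr : range h.basis = (σ : Set E) := by
    change range ((↑) : σ → E) = _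
    simp
  have := h.basis.centroid_mem_interior_convexHull
  rw [hr] at this
  exact ⟨_, this⟩

theorem bary_sum {κ : Finset E} (hκ : κ ⊆ σ) {c : E → ℝ} (hc : ∑ v ∈ κ, c v = 1) {v : E}
    (hv : v ∈ σ) [Decidable (v ∈ κ)] :
    bary σ v (∑ u ∈ κ, c u • u) = if v ∈ κ then c v else 0 := by
  rw [affine_sum_smul κ c _ _ hc]
  split_ifs with hvκ
  · rw [Finset.sum_eq_single_of_mem v hvκ fun u hu huv => by
      rw [h.bary_of_ne (hκ hu) hv huv, mul_zero], h.bary_self hv, mul_one]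
  · exact Finset.sum_eq_zero fun u hu => by
      rw [h.bary_of_ne (hκ hu) hv (fun e => hvκ (e ▸ hu)), mul_zero]

/-- Barycentric coordinates with respect to the simplex on the other side of a facet. -/
theorem bary_new_vertex [DecidableEq E] {v w : E} (hv : v ∈ σ)
    (hτ : IsSimplexCell (insert w (σ.erase v))) (x : E) :
    bary σ v x = bary (insert w (σ.erase v)) w x * bary σ v w := by
  refine hτ.affine_eq_mul (Finset.mem_insert_self _ _) (fun u hu huw => ?_) x
  rw [Finset.mem_insert, Finset.mem_erase] at hu
  rcases hu with rfl | ⟨h1, h2⟩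
  · exact absurd rfl huw
  · exact h.bary_of_ne h2 hv h1

/-- Where the coordinate of `v` vanishes, `x` is an affine combination of the common vertices, and
its weights serve both simplices. -/
theorem bary_common_vertex [DecidableEq E] {u v w : E}
    (hτ : IsSimplexCell (insert w (σ.erase v))) (hu : u ∈ σ) (huv : u ≠ v) {x : E}
    (hx : bary σ v x = 0) : bary (insert w (σ.erase v)) u x = bary σ u x := by
  have huτ : u ∈ insert w (σ.erase v) :=
    Finset.mem_insert_of_mem (Finset.mem_erase.2 ⟨huv, hu⟩)
  rw [h.affine_eq_sum (bary (insert w (σ.erase v)) u) x, Finset.sum_eq_single_of_mem u hu,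
    hτ.bary_self huτ, mul_one]
  intro u' hu' hne
  by_cases h' : u' = v
  · rw [h', hx, zero_mul]
  · rw [hτ.bary_of_ne (Finset.mem_insert_of_mem (Finset.mem_erase.2 ⟨h', hu'⟩)) huτ hne, mul_zero]

omit h in
/-- A family of affine functions dual to the points of `σ` makes `σ` affinely independent. -/
theorem of_dual [FiniteDimensional ℝ E] (hc : σ.card = Module.finrank ℝ E + 1)
    (f : E → E →ᵃ[ℝ] ℝ) (hf : ∀ v ∈ σ, f v v ≠ 0)
    (hf' : ∀ v ∈ σ, ∀ u ∈ σ, u ≠ v → f v u = 0) :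
    IsSimplexCell σ := by
  have hind : AffineIndependent ℝ ((↑) : σ → E) := by
    rw [affineIndependent_iff]
    intro s w hw hsum v hv
    have h1 : ∑ u ∈ s, w u * f v u = 0 := by
      rw [sum_mul_affine s w (fun u : σ => (u : E)) (f v), hw, hsum]
      simp
    rw [Finset.sum_eq_single_of_mem v hv fun u _ huv => by
      rw [hf' v v.2 u u.2 (fun e => huv (Subtype.ext e)), mul_zero]] at h1
    exact (mul_eq_zero.1 h1).resolve_right (hf v v.2)
  refine ⟨hind, ?_⟩
  have := hind.affineSpan_eq_top_iff_card_eq_finrank_add_one.2 (by simpa using hc)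
  simpa using this

/-- The coordinate of an omitted vertex would vanish on `ρ`, hence everywhere, but it is `1` at that
vertex. -/
theorem eq_of_subset_of_span {ρ : Finset E} (hρ : ρ ⊆ σ)
    (hs : affineSpan ℝ (ρ : Set E) = ⊤) : ρ = σ := by
  classical
  by_contra hne
  obtain ⟨v, hv, hvρ⟩ := Finset.exists_of_ssubset (hρ.ssubset_of_ne hne)
  have h0 : ∀ x : E, bary σ v x = 0 := by
    intro x
    have hx : x ∈ affineSpan ℝ (ρ : Set E) := by rw [hs]; trivial
    refine affineSpan_induction (p := fun z => bary σ v z = 0) hx ?_ ?_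
    · exact fun u hu => h.bary_of_ne (hρ hu) hv (fun e => hvρ (e ▸ hu))
    · intro c u v' w hu hv' hw
      rw [vsub_eq_sub, AffineMap.map_vadd, map_smul, ← vsub_eq_sub, AffineMap.linearMap_vsub, hu,
        hv', hw]
      simp
  exact one_ne_zero ((h.bary_self hv).symm.trans (h0 v))

end IsSimplexCell

end Barycentric

/-! ### Continuation along a segment -/

/-- A finite family of closed intervals that can always be continued to the right reaches `1`. -/
theorem exists_one_mem_of_continuation {ι : Type*} [Finite ι] (K : ι → Set ℝ)
    (hclosed : ∀ i, IsClosed (K i)) (hconv : ∀ i, Convex ℝ (K i))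
    (hstart : ∃ i, 0 ∈ K i ∧ ∃ s > 0, s ∈ K i)
    (hstep : ∀ i s t, 0 ≤ s → s < t → t < 1 → s ∈ K i → t ∈ K i →
      ∃ j, t ∈ K j ∧ ∃ ε > 0, t + ε ∈ K j) : ∃ i, 1 ∈ K i := by
  have hmem : ∀ i a b c, a ∈ K i → b ∈ K i → a ≤ c → c ≤ b → c ∈ K i := fun i a b c ha hb h1 h2 =>
    (hconv i).ordConnected.out ha hb ⟨h1, h2⟩
  -- Only sets that contain a nondegenerate piece of `[0, 1]` compete, since `hstep` asks for an
  -- earlier point `s` in the same set.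
  let I : Set ι := {i | ∃ s t, 0 ≤ s ∧ s < t ∧ t ≤ 1 ∧ s ∈ K i ∧ t ∈ K i}
  have hgreat : ∀ i ∈ I, ∃ m, IsGreatest (K i ∩ Icc 0 1) m := by
    rintro i ⟨s, t, h0, hst, h1, hs, -⟩
    exact ((isCompact_Icc).inter_left (hclosed i)).exists_isGreatest
      ⟨s, hs, h0, hst.le.trans h1⟩
  choose! m hm using hgreat
  have extend : ∀ j t, 0 ≤ t → t < 1 → t ∈ K j → (∃ ε > 0, t + ε ∈ K j) → j ∈ I ∧ t < m j := by
    rintro j t h0 h1 ht ⟨ε, hε, htε⟩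
    have hlt : t < min (t + ε) 1 := lt_min (by linarith) h1
    have hK : min (t + ε) 1 ∈ K j := hmem j t (t + ε) _ ht htε hlt.le (min_le_left _ _)
    have hj : j ∈ I := ⟨t, _, h0, hlt, min_le_right _ _, ht, hK⟩
    exact ⟨hj, hlt.trans_le ((hm j hj).2 ⟨hK, h0.trans hlt.le, min_le_right _ _⟩)⟩
  have hIne : I.Nonempty := by
    obtain ⟨i, h0, s, hs, hsi⟩ := hstart
    exact ⟨i, (extend i 0 le_rfl one_pos h0 ⟨s, hs, by simpa using hsi⟩).1⟩
  -- A set reaching farthest to the right must reach `1`; otherwise `hstep` at its right end gives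
  -- one that reaches farther.
  obtain ⟨i, hi, hmax⟩ := I.toFinite.exists_maximalFor m I hIne
  have hmi := (hm i hi).1
  rcases eq_or_lt_of_le hmi.2.2 with h1 | h1
  · exact ⟨i, h1 ▸ hmi.1⟩
  exfalso
  obtain ⟨s, t, h0, hst, ht1, hs, ht⟩ := hi
  have htm : t ≤ m i := (hm i ⟨s, t, h0, hst, ht1, hs, ht⟩).2 ⟨ht, h0.trans hst.le, ht1⟩
  obtain ⟨j, hj, hε⟩ := hstep i s (m i) h0 (hst.trans_le htm) h1 hs hmi.1
  obtain ⟨hjI, hlt⟩ := extend j (m i) hmi.2.1 h1 hj hε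
  exact absurd (hmax hjI hlt.le) (not_le.2 hlt)

/-! ### Avoiding finitely many hyperplanes -/

section Generic

variable {E : Type*} [NormedAddCommGroup E] [NormedSpace ℝ E]

/-- From a zero of `f` in `U`, a short move towards `z` makes `f` a nonzero multiple of `f z`. -/
theorem exists_affine_ne_zero [FiniteDimensional ℝ E] {U : Set E} (hU : IsOpen U)
    (hne : U.Nonempty) (f : E →ᵃ[ℝ] ℝ) {z : E} (hz : f z ≠ 0) : ∃ y ∈ U, f y ≠ 0 := by
  obtain ⟨x, hx⟩ := hne
  by_cases hfx : f x = 0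
  · have hc : Tendsto (fun t : ℝ => AffineMap.lineMap x z t) (𝓝[>] 0) (𝓝 x) := by
      have : Continuous fun t : ℝ => (AffineMap.lineMap x z t : E) := AffineMap.lineMap_continuous
      have h := (this.tendsto 0).mono_left (nhdsWithin_le_nhds (s := Ioi 0))
      simpa using h
    obtain ⟨t, ht, ht0⟩ := ((hc.eventually (hU.mem_nhds hx)).and self_mem_nhdsWithin).exists
    refine ⟨_, ht, ?_⟩
    rw [AffineMap.apply_lineMap, hfx, AffineMap.lineMap_apply_module, smul_zero, zero_add]
    exact smul_ne_zero (ne_of_gt ht0) hz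
  · exact ⟨x, hx, hfx⟩

theorem exists_generic [FiniteDimensional ℝ E] {F : Set (E →ᵃ[ℝ] ℝ)} (hF : F.Finite)
    (hne : ∀ f ∈ F, ∃ z, f z ≠ 0) {U : Set E} (hU : IsOpen U) (hUne : U.Nonempty) :
    ∃ y ∈ U, ∀ f ∈ F, f y ≠ 0 := by
  induction F, hF using Set.Finite.induction_on generalizing U with
  | empty => exact ⟨_, hUne.some_mem, by simp⟩
  | @insert f F _ _ ih =>
    obtain ⟨z, hz⟩ := hne f (mem_insert _ _)
    have hcont : Continuous f := f.continuous_of_finiteDimensional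
    obtain ⟨y, hyU, hy⟩ := exists_affine_ne_zero hU hUne f hz
    obtain ⟨y', ⟨hy'U, hy'⟩, hall⟩ := ih (fun g hg => hne g (mem_insert_of_mem _ hg))
      (hU.inter (isOpen_ne_fun hcont continuous_const)) ⟨y, hyU, hy⟩
    exact ⟨y', hy'U, fun g hg => hg.elim (fun e => e ▸ hy') (hall g)⟩

end Generic

/-! ### Pseudo-manifolds and facet crossings of generic segments -/

/-- A pure simplicial complex in which every facet of a cell lies on the boundary of `conv A` or is
shared with a cell on its other side, and no two cells lie on the same side of a common facet. -/
structure IsPseudoManifold {E : Type*} [NormedAddCommGroup E] [NormedSpace ℝ E] [DecidableEq E]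
    (A : Finset E) (T : Finset (Finset E)) : Prop where
  subset : ∀ σ ∈ T, σ ⊆ A
  cell : ∀ σ ∈ T, IsSimplexCell σ
  facet : ∀ σ ∈ T, ∀ v ∈ σ, (∀ p ∈ A, 0 ≤ bary σ v p) ∨
    ∃ w, w ∉ σ ∧ insert w (σ.erase v) ∈ T
  opposite : ∀ σ ∈ T, ∀ v ∈ σ, ∀ w, w ∉ σ → insert w (σ.erase v) ∈ T → bary σ v w < 0

namespace IsPseudoManifold

variable {E : Type*} [NormedAddCommGroup E] [NormedSpace ℝ E] {A : Finset E} {T : Finset (Finset E)}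

/-- The segment from the generic point `y` to `y'` meets the cells of `T` in general position. -/
structure Generic (T : Finset (Finset E)) (y y' : E) : Prop where
  left : ∀ σ ∈ T, ∀ v ∈ σ, bary σ v y ≠ 0
  skew : ∀ σ ∈ T, ∀ v ∈ σ, ∀ w ∈ σ, v ≠ w →
    bary σ v y * bary σ w y' - bary σ w y * bary σ v y' ≠ 0

/-- Once `y'` is fixed, skewness means that `y` avoids the zeros of an affine function whose value
at `v` is `bary σ w y'`. This is nonzero by `h'`, so `y'` has to be chosen before `y`. -/
theorem exists_generic_left [FiniteDimensional ℝ E] [DecidableEq E]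
    (hcell : ∀ σ ∈ T, IsSimplexCell σ) {y' : E}
    (h' : ∀ σ ∈ T, ∀ v ∈ σ, bary σ v y' ≠ 0) {U : Set E} (hU : IsOpen U) (hne : U.Nonempty) :
    ∃ y ∈ U, Generic T y y' := by
  let F1 : Set (E →ᵃ[ℝ] ℝ) := ⋃ σ ∈ T, ⋃ v ∈ σ, {bary σ v}
  let F2 : Set (E →ᵃ[ℝ] ℝ) := ⋃ σ ∈ T, ⋃ v ∈ σ, ⋃ w ∈ σ.erase v,
    {bary σ w y' • bary σ v - bary σ v y' • bary σ w}
  have hF : (F1 ∪ F2).Finite := by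
    refine Set.Finite.union ?_ ?_
    · exact T.finite_toSet.biUnion fun σ _ => σ.finite_toSet.biUnion fun v _ => finite_singleton _
    · exact T.finite_toSet.biUnion fun σ _ => σ.finite_toSet.biUnion fun v _ =>
        (σ.erase v).finite_toSet.biUnion fun w _ => finite_singleton _
  obtain ⟨y, hy, hall⟩ := exists_generic hF (by
    rintro f (hf | hf)
    · simp only [F1, mem_iUnion, mem_singleton_iff] at hf
      obtain ⟨σ, hσ, v, hv, rfl⟩ := hf
      exact ⟨y', h' σ hσ v hv⟩
    · simp only [F2, mem_iUnion, mem_singleton_iff] at hf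
      obtain ⟨σ, hσ, v, hv, w, hw, rfl⟩ := hf
      obtain ⟨hwv, hw⟩ := Finset.mem_erase.1 hw
      refine ⟨v, ?_⟩
      simp [(hcell σ hσ).bary_self hv, (hcell σ hσ).bary_of_ne hv hw hwv.symm, h' σ hσ w hw])
    hU hne
  refine ⟨y, hy, ⟨fun σ hσ v hv => ?_, fun σ hσ v hv w hw hvw => ?_⟩⟩
  · exact hall _ (Or.inl (by simp only [F1, mem_iUnion]; exact ⟨σ, hσ, v, hv, rfl⟩))
  · have := hall _ (Or.inr (by
      simp only [F2, mem_iUnion]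
      exact ⟨σ, hσ, v, hv, w, Finset.mem_erase.2 ⟨hvw.symm, hw⟩, rfl⟩))
    simp only [AffineMap.coe_sub, AffineMap.coe_smul, Pi.sub_apply, Pi.smul_apply,
      smul_eq_mul] at this
    intro h0
    exact this (by linarith)

theorem exists_generic_right [FiniteDimensional ℝ E] (hcell : ∀ σ ∈ T, IsSimplexCell σ)
    {U : Set E} (hU : IsOpen U) (hne : U.Nonempty) : ∃ y ∈ U, ∀ σ ∈ T, ∀ v ∈ σ, bary σ v y ≠ 0 := by
  have hF : (⋃ σ ∈ T, ⋃ v ∈ σ, {bary σ v} : Set (E →ᵃ[ℝ] ℝ)).Finite :=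
    T.finite_toSet.biUnion fun σ _ => σ.finite_toSet.biUnion fun v _ => finite_singleton _
  obtain ⟨y, hy, hall⟩ := exists_generic hF (by
    intro f hf
    simp only [mem_iUnion, mem_singleton_iff] at hf
    obtain ⟨σ, hσ, v, hv, rfl⟩ := hf
    exact ⟨v, by simp [(hcell σ hσ).bary_self hv]⟩) hU hne
  exact ⟨y, hy, fun σ hσ v hv => hall _ (by
    simp only [mem_iUnion]; exact ⟨σ, hσ, v, hv, rfl⟩)⟩

/-- What happens to a cell at the moment when a generic segment may leave it. -/
theorem crossing [DecidableEq E] (hT : IsPseudoManifold A T) {y y' : E} (hg : Generic T y y')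
    (hy' : y' ∈ convexHull ℝ (A : Set E)) {σ : Finset E} (hσ : σ ∈ T) {s t : ℝ} (hst : s < t)
    (ht1 : t < 1) (hs : AffineMap.lineMap y y' s ∈ convexHull ℝ (σ : Set E))
    (ht : AffineMap.lineMap y y' t ∈ convexHull ℝ (σ : Set E)) :
    ((∀ u ∈ σ, 0 < bary σ u (AffineMap.lineMap y y' t)) ∧
      ∃ ε > 0, ∀ r ∈ Icc t (t + ε), AffineMap.lineMap y y' r ∈ convexHull ℝ (σ : Set E)) ∨
    ∃ v ∈ σ, ∃ w, w ∉ σ ∧ insert w (σ.erase v) ∈ T ∧ bary σ v (AffineMap.lineMap y y' t) = 0 ∧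
      (∀ u ∈ σ, u ≠ v → 0 < bary σ u (AffineMap.lineMap y y' t)) ∧
      0 < bary σ v (AffineMap.lineMap y y' s) ∧
      ∃ ε > 0, ∀ r ∈ Icc t (t + ε),
        AffineMap.lineMap y y' r ∈ convexHull ℝ ((insert w (σ.erase v) : Finset E) : Set E) := by
  have hc := hT.cell σ hσ
  have hval : ∀ (f : E →ᵃ[ℝ] ℝ) (r : ℝ), f (AffineMap.lineMap y y' r) =
      (1 - r) * f y + r * f y' := fun f r => by
    rw [AffineMap.apply_lineMap, AffineMap.lineMap_apply_module]; simp
  have hcontf : ∀ f : E →ᵃ[ℝ] ℝ, Continuous fun r : ℝ => f (AffineMap.lineMap y y' r) := fun f => by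
    simp_rw [hval]; fun_prop
  -- positive coordinates stay positive for a while
  have hstay : ∀ (F : Set (E →ᵃ[ℝ] ℝ)), F.Finite → (∀ f ∈ F, 0 < f (AffineMap.lineMap y y' t)) →
      ∃ ε > 0, ∀ r ∈ Icc t (t + ε), ∀ f ∈ F, 0 < f (AffineMap.lineMap y y' r) := by
    intro F hF hpos
    have h1 : ∀ᶠ r in 𝓝 t, ∀ f ∈ F, 0 < f (AffineMap.lineMap y y' r) :=
      (Filter.eventually_all_finite hF).2 fun f hf =>
        (hcontf f).continuousAt.eventually (lt_mem_nhds (hpos f hf))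
    obtain ⟨ε, hε, hball⟩ := Metric.eventually_nhds_iff_ball.1 h1
    refine ⟨ε / 2, by positivity, fun r hr => hball r ?_⟩
    rw [Metric.mem_ball, Real.dist_eq, abs_lt]
    constructor <;> linarith [hr.1, hr.2]
  have hnn := hc.mem_convexHull.1 ht
  by_cases hz : ∃ v ∈ σ, bary σ v (AffineMap.lineMap y y' t) = 0
  · right
    obtain ⟨v, hv, hv0⟩ := hz
    -- Two coordinates vanishing at the same parameter would make the determinant in `Generic.skew`
    -- zero.
    have hothers : ∀ u ∈ σ, u ≠ v → 0 < bary σ u (AffineMap.lineMap y y' t) := by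
      intro u hu huv
      refine lt_of_le_of_ne (hnn u hu) fun h0 => hg.skew σ hσ u hu v hv huv ?_
      rw [hval] at hv0 h0
      have e1 : (1 - t) * (bary σ u y * bary σ v y' - bary σ v y * bary σ u y') = 0 := by
        linear_combination (-(bary σ v y')) * h0 - bary σ u y' * hv0
      rcases mul_eq_zero.1 e1 with h | h
      · linarith
      · exact h
    have hspos : 0 < bary σ v (AffineMap.lineMap y y' s) := by
      refine lt_of_le_of_ne (hc.mem_convexHull.1 hs v hv) fun h0 => hg.left σ hσ v hv ?_
      rw [hval] at hv0 h0
      have e1 : (t - s) * bary σ v y = 0 := by linear_combination (-t) * h0 - s * hv0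
      rcases mul_eq_zero.1 e1 with h | h
      · linarith
      · exact h
    -- Along the segment the coordinate is affine, positive at `s` and zero at `t > s`.
    have hlater : ∀ r, t < r → bary σ v (AffineMap.lineMap y y' r) < 0 := by
      intro r hr
      rw [hval] at hv0 hspos ⊢
      have e1 : (t - s) * ((1 - r) * bary σ v y + r * bary σ v y') =
          -((r - t) * ((1 - s) * bary σ v y + s * bary σ v y')) := by
        linear_combination (r - s) * hv0
      have : (t - s) * ((1 - r) * bary σ v y + r * bary σ v y') < 0 := by
        rw [e1]; exact neg_neg_of_pos (mul_pos (by linarith) hspos)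
      by_contra hcon
      exact absurd this (not_lt.2 (mul_nonneg (by linarith) (not_lt.1 hcon)))
    rcases hT.facet σ hσ v hv with hb | ⟨w, hw, hτ⟩
    -- The segment cannot leave through a boundary facet, as its end `y'` lies in `conv A`.
    · exfalso
      have h1 : bary σ v y' < 0 := by simpa using hlater 1 ht1
      have h2 : convexHull ℝ (A : Set E) ⊆ {x | 0 ≤ bary σ v x} :=
        convexHull_min (fun p hp => hb p hp)
          ((convex_Ici (𝕜 := ℝ) (0 : ℝ)).affine_preimage (bary σ v))
      exact absurd (h2 hy') (not_le.2 h1)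
    · refine ⟨v, hv, w, hw, hτ, hv0, hothers, hspos, ?_⟩
      have hcτ := hT.cell _ hτ
      have hneg := hT.opposite σ hσ v hv w hw hτ
      obtain ⟨ε, hε, hε'⟩ := hstay (⋃ u ∈ σ.erase v, {bary (insert w (σ.erase v)) u})
        ((σ.erase v).finite_toSet.biUnion fun v _ => finite_singleton _) (by
          intro f hf
          simp only [mem_iUnion, mem_singleton_iff] at hf
          obtain ⟨u, hu, rfl⟩ := hf
          obtain ⟨huv, hu⟩ := Finset.mem_erase.1 hu
          rw [hc.bary_common_vertex hcτ hu huv hv0]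
          exact hothers u hu huv)
      refine ⟨ε, hε, fun r hr => hcτ.mem_convexHull.2 fun u hu => ?_⟩
      rcases Finset.mem_insert.1 hu with rfl | hu'
      · have e := hc.bary_new_vertex hv hcτ (AffineMap.lineMap y y' r)
        have hle : bary σ v (AffineMap.lineMap y y' r) ≤ 0 := by
          rcases eq_or_lt_of_le hr.1 with h | h
          · rw [← h, hv0]
          · exact (hlater r h).le
        by_contra hcon
        rw [not_le] at hcon
        have := mul_pos_of_neg_of_neg hcon hneg
        linarith
      · exact (hε' r hr _ (by simp only [mem_iUnion]; exact ⟨u, hu', rfl⟩)).le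
  · left
    push Not at hz
    have hpos : ∀ u ∈ σ, 0 < bary σ u (AffineMap.lineMap y y' t) := fun u hu =>
      lt_of_le_of_ne (hnn u hu) (hz u hu).symm
    obtain ⟨ε, hε, hε'⟩ := hstay (⋃ u ∈ σ, {bary σ u})
      (σ.finite_toSet.biUnion fun v _ => finite_singleton _) (by
        intro f hf
        simp only [mem_iUnion, mem_singleton_iff] at hf
        obtain ⟨u, hu, rfl⟩ := hf
        exact hpos u hu)
    exact ⟨hpos, ε, hε, fun r hr => hc.mem_convexHull.2 fun u hu =>
      (hε' r hr _ (by simp only [mem_iUnion]; exact ⟨u, hu, rfl⟩)).le⟩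

end IsPseudoManifold

/-! ### From the local conditions to a triangulation -/

namespace IsPseudoManifold

variable {E : Type*} [NormedAddCommGroup E] [NormedSpace ℝ E] {A : Finset E}
  {T : Finset (Finset E)}

theorem isClosed_preimage (y y' : E) (σ : Finset E) :
    IsClosed {t : ℝ | AffineMap.lineMap y y' t ∈ convexHull ℝ (σ : Set E)} :=
  (σ.finite_toSet.isClosed_convexHull ℝ).preimage AffineMap.lineMap_continuous

theorem convex_preimage (y y' : E) (σ : Finset E) :
    Convex ℝ {t : ℝ | AffineMap.lineMap y y' t ∈ convexHull ℝ (σ : Set E)} :=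
  (convex_convexHull ℝ _).affine_preimage (AffineMap.lineMap y y')

theorem exists_start {σ : Finset E} {y y' : E} (hy : y ∈ interior (convexHull ℝ (σ : Set E))) :
    ∀ᶠ t in 𝓝 (0 : ℝ), AffineMap.lineMap y y' t ∈ convexHull ℝ (σ : Set E) := by
  have hc : Tendsto (fun t : ℝ => AffineMap.lineMap y y' t) (𝓝 0) (𝓝 y) := by
    have : Continuous fun t : ℝ => (AffineMap.lineMap y y' t : E) := AffineMap.lineMap_continuous
    simpa using this.tendsto 0
  exact hc.eventually (mem_interior_iff_mem_nhds.1 hy)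

/-- Following a generic segment from cell to cell. -/
theorem walk [DecidableEq E] (hT : IsPseudoManifold A T) {y y' : E} (hg : Generic T y y')
    (hy' : y' ∈ convexHull ℝ (A : Set E)) (P : Finset E → Prop) {σ₀ : Finset E} (hσ₀ : σ₀ ∈ T)
    (hy : y ∈ interior (convexHull ℝ (σ₀ : Set E))) (hP : P σ₀)
    (hstep : ∀ σ ∈ T, P σ → ∀ v ∈ σ, ∀ w, w ∉ σ → insert w (σ.erase v) ∈ T → ∀ t ∈ Icc (0 : ℝ) 1,
      bary σ v (AffineMap.lineMap y y' t) = 0 → P (insert w (σ.erase v))) :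
    ∃ τ ∈ T, P τ ∧ y' ∈ convexHull ℝ (τ : Set E) := by
  have : Finite {σ : Finset E // σ ∈ T ∧ P σ} :=
    (T.finite_toSet.subset fun σ hσ => hσ.1).to_subtype
  obtain ⟨⟨τ, hτ, hPτ⟩, h⟩ := exists_one_mem_of_continuation
    (ι := {σ : Finset E // σ ∈ T ∧ P σ})
    (fun σ => {t : ℝ | AffineMap.lineMap y y' t ∈ convexHull ℝ (σ.1 : Set E)})
    (fun σ => isClosed_preimage y y' σ.1) (fun σ => convex_preimage y y' σ.1) (by
      have h0 := exists_start (y' := y') hy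
      obtain ⟨s, hs, hs0⟩ := ((h0.filter_mono nhdsWithin_le_nhds).and
        (self_mem_nhdsWithin (s := Ioi (0 : ℝ)))).exists
      exact ⟨⟨σ₀, hσ₀, hP⟩, h0.self_of_nhds, s, hs0, hs⟩) (by
      rintro ⟨σ, hσ, hPσ⟩ s t h0 hst ht1 hs ht
      rcases hT.crossing hg hy' hσ hst ht1 hs ht with
        ⟨-, ε, hε, h⟩ | ⟨v, hv, w, hw, hτ, hv0, -, -, ε, hε, h⟩
      · exact ⟨⟨σ, hσ, hPσ⟩, ht, ε, hε, h _ ⟨by linarith, le_rfl⟩⟩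
      · exact ⟨⟨_, hτ, hstep σ hσ hPσ v hv w hw hτ t ⟨by linarith, ht1.le⟩ hv0⟩,
          h t ⟨le_rfl, by linarith⟩, ε, hε, h _ ⟨by linarith, le_rfl⟩⟩)
  exact ⟨τ, hτ, hPτ, by simpa using h⟩

/-- A pseudo-manifold whose cells cover some point exactly once. -/
structure Simple (T : Finset (Finset E)) (σ₀ : Finset E) (q : E) : Prop where
  mem : σ₀ ∈ T
  covers : q ∈ convexHull ℝ (σ₀ : Set E)
  once : ∀ τ ∈ T, τ ≠ σ₀ → q ∉ convexHull ℝ (τ : Set E)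

theorem convexHull_subset [DecidableEq E] (hT : IsPseudoManifold A T) {σ : Finset E} (hσ : σ ∈ T) :
    convexHull ℝ (σ : Set E) ⊆ convexHull ℝ (A : Set E) :=
  convexHull_mono (by exact_mod_cast hT.subset σ hσ)

variable [FiniteDimensional ℝ E]

/-- `q` may lie on the boundary of its cell. The complement of the other cells is open, so a generic
interior point near `q` is still covered only once. -/
theorem exists_target (hcell : ∀ σ ∈ T, IsSimplexCell σ) {σ₀ : Finset E} {q : E}
    (hq : Simple T σ₀ q) : ∃ y', (∀ σ ∈ T, ∀ v ∈ σ, bary σ v y' ≠ 0) ∧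
      y' ∈ interior (convexHull ℝ (σ₀ : Set E)) ∧
      ∀ τ ∈ T, τ ≠ σ₀ → y' ∉ convexHull ℝ (τ : Set E) := by
  let V : Set E := ⋂ τ ∈ {τ | τ ∈ T ∧ τ ≠ σ₀}, (convexHull ℝ (τ : Set E))ᶜ
  have hV : IsOpen V := (T.finite_toSet.subset fun σ hσ => hσ.1).isOpen_biInter
    fun τ _ => (τ.finite_toSet.isClosed_convexHull ℝ).isOpen_compl
  have hqV : q ∈ V := mem_iInter₂.2 fun τ hτ => hq.once τ hτ.1 hτ.2
  have hcl : q ∈ closure (interior (convexHull ℝ (σ₀ : Set E))) := by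
    rw [(convex_convexHull ℝ _).closure_interior_eq_closure_of_nonempty_interior
      (hcell _ hq.mem).interior_nonempty]
    exact subset_closure hq.covers
  obtain ⟨y', ⟨h1, h2⟩, h3⟩ := exists_generic_right hcell (hV.inter isOpen_interior)
    (mem_closure_iff.1 hcl V hV hqV)
  exact ⟨y', h3, h2, fun τ hτ hne => mem_iInter₂.1 h1 τ ⟨hτ, hne⟩⟩

variable [DecidableEq E] (hT : IsPseudoManifold A T) {σ₀ : Finset E} {q : E} (hq : Simple T σ₀ q)
include hT hq

/-- Distinct cells have disjoint interiors. -/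
theorem disjoint_interior {σ₁ σ₂ : Finset E} (h₁ : σ₁ ∈ T) (h₂ : σ₂ ∈ T) (hne : σ₁ ≠ σ₂) :
    Disjoint (interior (convexHull ℝ (σ₁ : Set E))) (interior (convexHull ℝ (σ₂ : Set E))) := by
  rw [disjoint_iff_inter_eq_empty, ← not_nonempty_iff_eq_empty]
  intro hnon
  obtain ⟨y', hy'gen, hy'σ, hy'not⟩ := exists_target hT.cell hq
  obtain ⟨y, ⟨hy1, hy2⟩, hg⟩ := exists_generic_left hT.cell hy'gen
    (isOpen_interior.inter isOpen_interior) hnon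
  have hy' : y' ∈ convexHull ℝ (A : Set E) := hT.convexHull_subset hq.mem (interior_subset hy'σ)
  -- Two cells are followed simultaneously from a supposed common interior point `y` to `y'`. They
  -- stay different, so `y'` would be covered twice.
  have : Finite {p : Finset E × Finset E // p.1 ∈ T ∧ p.2 ∈ T ∧ p.1 ≠ p.2} :=
    ((T ×ˢ T).finite_toSet.subset fun p hp =>
      Finset.mem_coe.2 (Finset.mem_product.2 ⟨hp.1, hp.2.1⟩)).to_subtype
  obtain ⟨⟨⟨τ₁, τ₂⟩, hτ₁, hτ₂, hτ⟩, hend1, hend2⟩ := exists_one_mem_of_continuation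
    (ι := {p : Finset E × Finset E // p.1 ∈ T ∧ p.2 ∈ T ∧ p.1 ≠ p.2})
    (fun p => {t : ℝ | AffineMap.lineMap y y' t ∈ convexHull ℝ (p.1.1 : Set E)} ∩
      {t : ℝ | AffineMap.lineMap y y' t ∈ convexHull ℝ (p.1.2 : Set E)})
    (fun p => (isClosed_preimage y y' _).inter (isClosed_preimage y y' _))
    (fun p => (convex_preimage y y' _).inter (convex_preimage y y' _)) (by
      have h0 := (exists_start (y' := y') hy1).and (exists_start (y' := y') hy2)
      obtain ⟨s, hs, hs0⟩ := ((h0.filter_mono nhdsWithin_le_nhds).and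
        (self_mem_nhdsWithin (s := Ioi (0 : ℝ)))).exists
      exact ⟨⟨(σ₁, σ₂), h₁, h₂, hne⟩, h0.self_of_nhds, s, hs0, hs⟩) (by
      rintro ⟨⟨σ, σ'⟩, hσ, hσ', hne'⟩ s t h0 hst ht1 ⟨hs, hs'⟩ ⟨ht, ht'⟩
      dsimp only [mem_ofPred_eq] at hσ hσ' hne' hs hs' ht ht'
      -- it suffices to continue the two cells to different cells
      suffices H : ∃ τ ∈ T, ∃ τ' ∈ T, τ ≠ τ' ∧ (∃ ε > 0, ∀ r ∈ Icc t (t + ε),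
          AffineMap.lineMap y y' r ∈ convexHull ℝ (τ : Set E)) ∧ (∃ ε > 0, ∀ r ∈ Icc t (t + ε),
          AffineMap.lineMap y y' r ∈ convexHull ℝ (τ' : Set E)) by
        obtain ⟨τ, hτ, τ', hτ', hττ', ⟨ε, hε, h⟩, ε', hε', h'⟩ := H
        exact ⟨⟨(τ, τ'), hτ, hτ', hττ'⟩, ⟨h t ⟨le_rfl, by linarith⟩, h' t ⟨le_rfl, by linarith⟩⟩,
          min ε ε', lt_min hε hε', h _ ⟨by linarith [lt_min hε hε'], by linarith [min_le_left ε ε']⟩,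
          h' _ ⟨by linarith [lt_min hε hε'], by linarith [min_le_right ε ε']⟩⟩
      rcases hT.crossing hg hy' hσ hst ht1 hs ht with
        ⟨hpos, ε, hε, h⟩ | ⟨v, hv, w, hw, hτ, hv0, hoth, hs0, ε, hε, h⟩ <;>
      rcases hT.crossing hg hy' hσ' hst ht1 hs' ht' with
        ⟨hpos', ε', hε', h'⟩ | ⟨v', hv', w', hw', hτ', hv0', hoth', hs0', ε', hε', h'⟩
      · exact ⟨σ, hσ, σ', hσ', hne', ⟨ε, hε, h⟩, ε', hε', h'⟩
      · refine ⟨σ, hσ, _, hτ', ?_, ⟨ε, hε, h⟩, ε', hε', h'⟩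
        rintro rfl
        have := hpos w' (Finset.mem_insert_self _ _)
        have e := (hT.cell σ' hσ').bary_new_vertex hv' (hT.cell _ hτ')
          (AffineMap.lineMap y y' t)
        have hneg := hT.opposite σ' hσ' v' hv' w' hw' hτ'
        rw [hv0'] at e
        nlinarith
      · refine ⟨_, hτ, σ', hσ', ?_, ⟨ε, hε, h⟩, ε', hε', h'⟩
        rintro rfl
        have := hpos' w (Finset.mem_insert_self _ _)
        have e := (hT.cell σ hσ).bary_new_vertex hv (hT.cell _ hτ)
          (AffineMap.lineMap y y' t)
        have hneg := hT.opposite σ hσ v hv w hw hτ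
        rw [hv0] at e
        nlinarith
      · refine ⟨_, hτ, _, hτ', ?_, ⟨ε, hε, h⟩, ε', hε', h'⟩
        intro heq
        have hcτ := hT.cell _ hτ
        -- the only vanishing coordinate in the common cell is that of the new vertex
        have hww : w = w' := by
          by_contra hww
          have hmem : w ∈ insert w' (σ'.erase v') := heq ▸ Finset.mem_insert_self _ _
          have hmem' := (Finset.mem_insert.1 hmem).resolve_left hww
          obtain ⟨h1, h2⟩ := Finset.mem_erase.1 hmem'
          have e1 := (hT.cell σ' hσ').bary_common_vertex (hT.cell _ hτ') h2 h1 hv0'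
          have e2 := hoth' w h2 h1
          have e3 := (hT.cell σ hσ).bary_new_vertex hv hcτ (AffineMap.lineMap y y' t)
          have hneg := hT.opposite σ hσ v hv w hw hτ
          rw [hv0, heq, e1] at e3
          nlinarith
        subst hww
        have her : σ.erase v = σ'.erase v' := by
          have := congrArg (fun s => s.erase w) heq
          simpa [Finset.erase_insert, Finset.mem_erase, hw, hw'] using this
        have hvσ : v' ∉ σ := by
          intro hmem
          by_cases hvv : v' = v
          · exact hne' (by rw [← Finset.insert_erase hv, ← Finset.insert_erase hv', her, hvv])
          · exact Finset.notMem_erase v' σ' (her ▸ Finset.mem_erase.2 ⟨hvv, hmem⟩)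
        have hins : insert v' (σ.erase v) = σ' := by rw [her, Finset.insert_erase hv']
        -- Both old cells contain the facet just crossed, so they lie on opposite sides of it, yet
        -- the point at time `s` is strictly on the inner side of each.
        have hneg := hT.opposite σ hσ v hv v' hvσ (hins ▸ hσ')
        have e := (hT.cell σ hσ).bary_new_vertex hv (hins ▸ hT.cell _ hσ')
          (AffineMap.lineMap y y' s)
        rw [hins] at e
        nlinarith)
  simp only [mem_ofPred_eq, AffineMap.lineMap_apply_one] at hend1 hend2
  by_cases h : τ₁ = σ₀
  · exact hy'not τ₂ hτ₂ (fun e => hτ (h.trans e.symm)) hend2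
  · exact hy'not τ₁ hτ₁ h hend1

theorem eq_of_mem_interior {σ τ : Finset E} (hσ : σ ∈ T) (hτ : τ ∈ T) {x : E}
    (hxσ : x ∈ convexHull ℝ (σ : Set E)) (hxτ : x ∈ interior (convexHull ℝ (τ : Set E))) :
    σ = τ := by
  by_contra hne
  have hcl : x ∈ closure (interior (convexHull ℝ (σ : Set E))) := by
    rw [(convex_convexHull ℝ _).closure_interior_eq_closure_of_nonempty_interior
      (hT.cell _ hσ).interior_nonempty]
    exact subset_closure hxσ
  obtain ⟨z, hz, hz'⟩ := mem_closure_iff.1 hcl _ isOpen_interior hxτ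
  exact (Set.disjoint_left.1 (hT.disjoint_interior hq hσ hτ hne)) hz' hz

/-- An uncovered point would give an open uncovered set inside `conv A`, but the walk from `σ₀` to a
generic point of it ends in a cell containing that point. -/
theorem cover : (⋃ σ ∈ T, convexHull ℝ (σ : Set E)) = convexHull ℝ (A : Set E) := by
  refine Subset.antisymm (iUnion₂_subset fun σ hσ => hT.convexHull_subset hσ) fun z hz => ?_
  by_contra hzU
  have hU : IsClosed (⋃ σ ∈ T, convexHull ℝ (σ : Set E)) :=
    T.finite_toSet.isClosed_biUnion fun σ _ => σ.finite_toSet.isClosed_convexHull ℝ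
  have hint : (interior (convexHull ℝ (A : Set E))).Nonempty :=
    (hT.cell _ hq.mem).interior_nonempty.mono (interior_mono (hT.convexHull_subset hq.mem))
  have hcl : z ∈ closure (interior (convexHull ℝ (A : Set E))) := by
    rw [(convex_convexHull ℝ _).closure_interior_eq_closure_of_nonempty_interior hint]
    exact subset_closure hz
  have hnon := mem_closure_iff.1 hcl _ hU.isOpen_compl hzU
  obtain ⟨y', ⟨hy'U, hy'A⟩, hgen⟩ := exists_generic_right hT.cell
    (hU.isOpen_compl.inter isOpen_interior) hnon
  obtain ⟨y, hy, hg⟩ := exists_generic_left hT.cell hgen isOpen_interior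
    (hT.cell _ hq.mem).interior_nonempty
  obtain ⟨τ, hτ, -, hmem⟩ := hT.walk hg (interior_subset hy'A) (fun _ => True) hq.mem hy trivial
    (fun _ _ _ _ _ _ _ _ _ _ _ => trivial)
  exact hy'U (mem_iUnion₂.2 ⟨τ, hτ, hmem⟩)

/-- The carrier of a common point of two cells is a common face. -/
theorem carrier_subset {σ τ : Finset E} (hσ : σ ∈ T) (hτ : τ ∈ T) {x : E}
    (hxσ : x ∈ convexHull ℝ (σ : Set E)) (hxτ : x ∈ convexHull ℝ (τ : Set E)) {v : E}
    (hv : v ∈ σ) (hvx : 0 < bary σ v x) : v ∈ τ := by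
  -- a neighbourhood of `x` in which no positive coordinate vanishes
  have hcont : ∀ (ρ : Finset E) (u : E), Continuous (bary ρ u) := fun ρ u =>
    (bary ρ u).continuous_of_finiteDimensional
  have hnear : ∀ᶠ z in 𝓝 x, ∀ ρ ∈ T, ∀ u ∈ ρ, 0 < bary ρ u x → 0 < bary ρ u z := by
    refine (Filter.eventually_all_finset T).2 fun ρ _ =>
      (Filter.eventually_all_finset ρ).2 fun u _ => ?_
    by_cases h : 0 < bary ρ u x
    · exact ((hcont ρ u).continuousAt.eventually (lt_mem_nhds h)).mono fun z hz _ => hz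
    · exact Eventually.of_forall fun z hz => absurd hz h
  obtain ⟨r, hr, hball⟩ := Metric.eventually_nhds_iff_ball.1 hnear
  have hcl : ∀ ρ ∈ T, x ∈ convexHull ℝ (ρ : Set E) →
      (Metric.ball x r ∩ interior (convexHull ℝ (ρ : Set E))).Nonempty := by
    intro ρ hρ hx
    refine mem_closure_iff.1 ?_ _ Metric.isOpen_ball (Metric.mem_ball_self hr)
    rw [(convex_convexHull ℝ _).closure_interior_eq_closure_of_nonempty_interior
      (hT.cell _ hρ).interior_nonempty]
    exact subset_closure hx
  obtain ⟨y', ⟨hy'r, hy'τ⟩, hgen⟩ := exists_generic_right hT.cell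
    (Metric.isOpen_ball.inter isOpen_interior) (hcl τ hτ hxτ)
  obtain ⟨y, ⟨hyr, hyσ⟩, hg⟩ := exists_generic_left hT.cell hgen
    (Metric.isOpen_ball.inter isOpen_interior) (hcl σ hσ hxσ)
  -- The carrier of `x` in `σ`. A walk from `σ` to `τ` close to `x` never drops one of these
  -- vertices.
  let κ : Finset E := σ.filter fun u => 0 < bary σ u x
  have hσx := (hT.cell σ hσ).mem_convexHull.1 hxσ
  have hzero : ∀ u ∈ σ, u ∉ κ → bary σ u x = 0 := fun u hu hκ =>
    le_antisymm (not_lt.1 fun h => hκ (Finset.mem_filter.2 ⟨hu, h⟩)) (hσx u hu)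
  have hsum : ∑ u ∈ κ, bary σ u x = 1 := by
    rw [← (hT.cell σ hσ).sum_bary x]
    exact Finset.sum_subset (Finset.filter_subset _ _) fun u hu hκ => hzero u hu hκ
  have hsmul : ∑ u ∈ κ, bary σ u x • u = x := by
    conv_rhs => rw [← (hT.cell σ hσ).sum_bary_smul x]
    exact Finset.sum_subset (Finset.filter_subset _ _) fun u hu hκ => by
      rw [hzero u hu hκ, zero_smul]
  obtain ⟨ρ, hρ, hκ, hmem⟩ := hT.walk hg (hT.convexHull_subset hτ (interior_subset hy'τ))
    (fun ρ => κ ⊆ ρ) hσ hyσ (Finset.filter_subset _ _) (by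
      intro ρ hρ hκρ u hu w _ _ t ht h0 u' hu'
      have hseg : AffineMap.lineMap y y' t ∈ Metric.ball x r :=
        (convex_ball x r).segment_subset hyr hy'r (by
          rw [segment_eq_image_lineMap]; exact ⟨t, ht, rfl⟩)
      have hne : u' ≠ u := by
        rintro rfl
        -- As `κ ⊆ ρ`, the point `x` has the same positive coordinate in `ρ`; it stays positive on
        -- the ball, so the facet opposite `u'` is not met there.
        have h1 : bary ρ u' x = bary σ u' x := by
          conv_lhs => rw [← hsmul]
          rw [(hT.cell ρ hρ).bary_sum hκρ hsum hu, if_pos hu']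
        have h2 := hball _ hseg ρ hρ u' hu (h1 ▸ (Finset.mem_filter.1 hu').2)
        exact h2.ne' h0
      exact Finset.mem_insert_of_mem (Finset.mem_erase.2 ⟨hne, hκρ hu'⟩))
  rw [← hT.eq_of_mem_interior hq hρ hτ hmem hy'τ]
  exact hκ (Finset.mem_filter.2 ⟨hv, hvx⟩)

theorem inter_eq {σ τ : Finset E} (hσ : σ ∈ T) (hτ : τ ∈ T) :
    convexHull ℝ (σ : Set E) ∩ convexHull ℝ (τ : Set E) =
      {x ∈ convexHull ℝ (σ : Set E) | ∀ v ∈ σ, v ∉ τ → bary σ v x = 0} := by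
  ext x
  constructor
  · rintro ⟨hxσ, hxτ⟩
    refine ⟨hxσ, fun v hv hvτ => le_antisymm (not_lt.1 fun h => hvτ ?_)
      ((hT.cell σ hσ).mem_convexHull.1 hxσ v hv)⟩
    exact hT.carrier_subset hq hσ hτ hxσ hxτ hv h
  · rintro ⟨hxσ, h0⟩
    refine ⟨hxσ, ?_⟩
    have hsub : ∀ v ∈ σ, v ∉ σ ∩ τ → bary σ v x = 0 := fun v hv hvτ =>
      h0 v hv fun h => hvτ (Finset.mem_inter.2 ⟨hv, h⟩)
    have hsum : ∑ u ∈ σ ∩ τ, bary σ u x = 1 := by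
      rw [← (hT.cell σ hσ).sum_bary x]
      exact Finset.sum_subset Finset.inter_subset_left hsub
    have hsmul : ∑ u ∈ σ ∩ τ, bary σ u x • u = x := by
      conv_rhs => rw [← (hT.cell σ hσ).sum_bary_smul x]
      exact Finset.sum_subset Finset.inter_subset_left fun u hu hκ => by
        rw [hsub u hu hκ, zero_smul]
    rw [← hsmul]
    exact (convex_convexHull ℝ _).sum_mem
      (fun u hu => (hT.cell σ hσ).mem_convexHull.1 hxσ u (Finset.mem_inter.1 hu).1) hsum
      fun u hu => subset_convexHull ℝ _ (Finset.mem_inter.1 hu).2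

theorem isExposed {σ τ : Finset E} (hσ : σ ∈ T) (hτ : τ ∈ T) :
    IsExposed ℝ (convexHull ℝ (σ : Set E))
      (convexHull ℝ (σ : Set E) ∩ convexHull ℝ (τ : Set E)) := by
  rintro ⟨x₀, hx₀⟩
  rw [hT.inter_eq hq hσ hτ] at hx₀ ⊢
  -- The sum of the coordinates at the vertices outside `τ` is nonnegative on `σ` and vanishes
  -- exactly on the common face.
  let f : E →ᵃ[ℝ] ℝ := ∑ v ∈ σ \ τ, bary σ v
  have hfval : ∀ x, f x = ∑ v ∈ σ \ τ, bary σ v x := fun x => affine_sum_apply _ _ x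
  have hlin : ∀ x, f x = f.linear x + f 0 := fun x => congrFun f.decomp x
  have hnn : ∀ x ∈ convexHull ℝ (σ : Set E), ∀ v ∈ σ \ τ, 0 ≤ bary σ v x := fun x hx v hv =>
    (hT.cell σ hσ).mem_convexHull.1 hx v (Finset.mem_sdiff.1 hv).1
  have h0 : f x₀ = 0 := by
    rw [hfval]
    exact Finset.sum_eq_zero fun v hv =>
      hx₀.2 v (Finset.mem_sdiff.1 hv).1 (Finset.mem_sdiff.1 hv).2
  refine ⟨-LinearMap.toContinuousLinearMap f.linear, ?_⟩
  ext x
  refine and_congr_right fun hx => ⟨fun h y hy => ?_, fun h v hv hvτ => ?_⟩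
  · have h1 : f x = 0 := by
      rw [hfval]
      exact Finset.sum_eq_zero fun v hv => h v (Finset.mem_sdiff.1 hv).1 (Finset.mem_sdiff.1 hv).2
    have h2 : 0 ≤ f y := by
      rw [hfval]; exact Finset.sum_nonneg (hnn y hy)
    rw [hlin] at h1 h2
    simp only [neg_apply, LinearMap.coe_toContinuousLinearMap']
    linarith
  · have h1 := h x₀ hx₀.1
    simp only [neg_apply, LinearMap.coe_toContinuousLinearMap'] at h1
    have h2 : f x ≤ 0 := by
      rw [hlin] at h0 ⊢; linarith
    rw [hfval] at h2
    have h3 := le_antisymm h2 (Finset.sum_nonneg (hnn x hx))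
    exact (Finset.sum_eq_zero_iff_of_nonneg (hnn x hx)).1 h3 v (Finset.mem_sdiff.2 ⟨hv, hvτ⟩)

theorem mem_of_mem_convexHull {σ τ : Finset E} (hσ : σ ∈ T) (hτ : τ ∈ T) {v : E} (hv : v ∈ σ)
    (h : v ∈ convexHull ℝ ((σ : Set E) ∩ (τ : Set E))) : v ∈ τ := by
  refine hT.carrier_subset hq hσ hτ (subset_convexHull ℝ _ hv)
    (convexHull_mono inter_subset_right h) hv ?_
  rw [(hT.cell σ hσ).bary_self hv]
  exact one_pos

/-- A pseudo-manifold that covers some point exactly once is a triangulation. -/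
theorem isPolyhedralSubdivision : IsPolyhedralSubdivision A T where
  subset := hT.subset
  spanning σ hσ := (hT.cell σ hσ).2
  face σ hσ τ hτ := ⟨hT.isExposed hq hσ hτ, by
    rw [inter_comm]; exact hT.isExposed hq hτ hσ⟩
  agree σ hσ τ hτ := by
    ext v
    constructor
    · rintro ⟨h, hv⟩
      exact ⟨h, hT.mem_of_mem_convexHull hq hσ hτ hv h⟩
    · rintro ⟨h, hv⟩
      exact ⟨h, hT.mem_of_mem_convexHull hq hτ hσ hv (by rwa [inter_comm])⟩
  cover := hT.cover hq

end IsPseudoManifold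

/-! ### Simplicial cells under refinement, rigid cells under coarsening -/

section Rigid

variable {E : Type*} [NormedAddCommGroup E] [NormedSpace ℝ E]

/-- An exposed face that contains an interior point is everything. -/
theorem convexHull_subset_of_isExposed {B C : Set E} (h : IsExposed ℝ B C) {z : E} (hz : z ∈ C)
    (hzB : z ∈ interior B) : B ⊆ C := by
  obtain ⟨l, hl⟩ := h ⟨z, hz⟩
  rw [hl] at hz ⊢
  have hmax : IsLocalMax l z := by
    filter_upwards [mem_interior_iff_mem_nhds.1 hzB] with y hy using hz.2 y hy
  -- A linear functional is its own derivative, which vanishes at an interior maximum.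
  have h0 : l = 0 := hmax.hasFDerivAt_eq_zero l.hasFDerivAt
  exact fun x hx => ⟨hx, fun y _ => by simp [h0]⟩

/-- Both sets contain the extreme points of the common hull, which generate it. With `agree`, cells
with equal hulls become equal as point sets. -/
theorem convexHull_inter_eq_of_convexHull_eq {σ τ : Finset E}
    (h : convexHull ℝ (σ : Set E) = convexHull ℝ (τ : Set E)) :
    convexHull ℝ ((σ : Set E) ∩ (τ : Set E)) = convexHull ℝ (σ : Set E) := by
  refine Subset.antisymm (convexHull_mono inter_subset_left) ?_
  have hext : (convexHull ℝ (σ : Set E)).extremePoints ℝ ⊆ (σ : Set E) ∩ (τ : Set E) :=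
    subset_inter extremePoints_convexHull_subset (h ▸ extremePoints_convexHull_subset)
  have hfin : ((σ : Set E) ∩ (τ : Set E)).Finite := σ.finite_toSet.inter_of_left _
  calc convexHull ℝ (σ : Set E)
      = closure (convexHull ℝ ((convexHull ℝ (σ : Set E)).extremePoints ℝ)) :=
        (closure_convexHull_extremePoints (σ.finite_toSet.isCompact_convexHull ℝ)
          (convex_convexHull ℝ _)).symm
    _ ⊆ closure (convexHull ℝ ((σ : Set E) ∩ (τ : Set E))) := closure_mono (convexHull_mono hext)
    _ = _ := (hfin.isClosed_convexHull ℝ).closure_eq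

namespace IsPolyhedralSubdivision

variable {A : Finset E} {S S' : Finset (Finset E)}

/-- Two cells, one of which contains an interior point of the other, are equal. -/
theorem eq_of_mem_interior (hS : IsPolyhedralSubdivision A S) {σ τ : Finset E} (hσ : σ ∈ S)
    (hτ : τ ∈ S) {z : E} (hzσ : z ∈ convexHull ℝ (σ : Set E))
    (hzτ : z ∈ interior (convexHull ℝ (τ : Set E))) : σ = τ := by
  have hz : z ∈ convexHull ℝ (σ : Set E) ∩ convexHull ℝ (τ : Set E) :=
    ⟨hzσ, interior_subset hzτ⟩
  have h1 := convexHull_subset_of_isExposed (hS.face σ hσ τ hτ).2 hz hzτ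
  have h2 := convexHull_subset_of_isExposed (hS.face σ hσ τ hτ).1 hz
    (interior_mono (h1.trans inter_subset_left) hzτ)
  have heq : convexHull ℝ (σ : Set E) = convexHull ℝ (τ : Set E) :=
    Subset.antisymm (h2.trans inter_subset_right) (h1.trans inter_subset_left)
  have hag := hS.agree σ hσ τ hτ
  rw [convexHull_inter_eq_of_convexHull_eq heq, inter_eq_right.2 (subset_convexHull ℝ _), heq,
    inter_eq_right.2 (subset_convexHull ℝ _)] at hag
  exact_mod_cast hag

/-- A simplicial cell survives in every refinement. -/
theorem mem_of_refines (hS : IsPolyhedralSubdivision A S) (hS' : IsPolyhedralSubdivision A S')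
    (h : Refines S' S) {σ : Finset E} (hσ : σ ∈ S) (hc : IsSimplexCell σ) : σ ∈ S' := by
  obtain ⟨z, hz⟩ := hc.interior_nonempty
  have hzA : z ∈ ⋃ τ ∈ S', convexHull ℝ (τ : Set E) := by
    rw [hS'.cover]
    exact convexHull_mono (by exact_mod_cast hS.subset σ hσ) (interior_subset hz)
  obtain ⟨τ, hτ, hzτ⟩ := mem_iUnion₂.1 hzA
  obtain ⟨ρ, hρ, hτρ⟩ := h τ hτ
  have hρσ := hS.eq_of_mem_interior hρ hσ
    (convexHull_mono (by exact_mod_cast hτρ) hzτ) hz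
  subst hρσ
  exact hc.eq_of_subset_of_span hτρ (hS'.spanning τ hτ) ▸ hτ

/-- A cell that contains a simplex `G` and a point beyond one of its facets contains the
neighbouring simplex, provided the latter lies in one cell. -/
theorem mem_of_beyond [DecidableEq E] (hS : IsPolyhedralSubdivision A S) {c c' G : Finset E}
    (hc : c ∈ S) (hc' : c' ∈ S) (hG : IsSimplexCell G) (hGc : G ⊆ c) {v w p : E} (hv : v ∈ G)
    (hH : IsSimplexCell (insert w (G.erase v))) (hHc' : insert w (G.erase v) ⊆ c')
    (hw : bary G v w < 0) (hp : p ∈ c) (hpv : bary G v p < 0) : c = c' := by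
  -- If `v` were the only vertex, its coordinate would be constantly `1`, contrary to `hw`.
  have hne : (G.erase v).Nonempty := by
    rw [Finset.nonempty_iff_ne_empty]
    intro h0
    have h1 := hG.sum_bary w
    rw [← Finset.add_sum_erase _ _ hv, h0, Finset.sum_empty] at h1
    linarith
  have hk : (0 : ℝ) < (G.erase v).card := by exact_mod_cast hne.card_pos
  let κ : ℝ := ((G.erase v).card : ℝ)⁻¹
  have hκ : 0 < κ := inv_pos.2 hk
  have hsum : ∑ _u ∈ G.erase v, κ = 1 := by
    rw [Finset.sum_const, nsmul_eq_mul]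
    exact mul_inv_cancel₀ hk.ne'
  -- Moving from the barycentre `b` of the common facet a little towards `p` stays in `conv c` and
  -- enters the interior of the neighbouring simplex.
  let b : E := ∑ u ∈ G.erase v, κ • u
  have hbc : b ∈ convexHull ℝ (c : Set E) := (convex_convexHull ℝ _).sum_mem
    (fun _ _ => hκ.le) hsum fun u hu => subset_convexHull ℝ _ (hGc (Finset.mem_of_mem_erase hu))
  have hsub : G.erase v ⊆ insert w (G.erase v) := Finset.subset_insert _ _
  have hbw : bary G v b = 0 := by
    rw [hG.bary_sum (Finset.erase_subset _ _) hsum hv, if_neg (Finset.notMem_erase _ _)]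
  have hev : ∀ᶠ t in 𝓝[>] (0 : ℝ), ∀ u ∈ insert w (G.erase v),
      0 < bary (insert w (G.erase v)) u (AffineMap.lineMap b p t) := by
    refine (Filter.eventually_all_finset _).2 fun u hu => ?_
    have hval : ∀ (f : E →ᵃ[ℝ] ℝ) (r : ℝ), f (AffineMap.lineMap b p r) =
        (1 - r) * f b + r * f p := fun f r => by
      rw [AffineMap.apply_lineMap, AffineMap.lineMap_apply_module]; simp
    by_cases hu' : u ∈ G.erase v
    · have h0 : 0 < bary (insert w (G.erase v)) u b := by
        rw [hH.bary_sum hsub hsum hu, if_pos hu']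
        exact hκ
      have hcont : Continuous fun r : ℝ =>
          bary (insert w (G.erase v)) u (AffineMap.lineMap b p r) := by
        simp_rw [hval]; fun_prop
      exact (hcont.continuousAt.eventually (lt_mem_nhds (by simpa using h0))).filter_mono
        nhdsWithin_le_nhds
    · have huw : u = w := (Finset.mem_insert.1 hu).resolve_right hu'
      subst huw
      filter_upwards [self_mem_nhdsWithin] with t ht
      have e := hG.bary_new_vertex hv hH (AffineMap.lineMap b p t)
      rw [hval, hbw, mul_zero, zero_add] at e
      have h1 : t * bary G v p < 0 := mul_neg_of_pos_of_neg ht hpv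
      by_contra hcon
      have := mul_nonneg_of_nonpos_of_nonpos (not_lt.1 hcon) hw.le
      linarith
  have h1 : ∀ᶠ t in 𝓝[>] (0 : ℝ), t < 1 := (gt_mem_nhds one_pos).filter_mono nhdsWithin_le_nhds
  obtain ⟨t, ⟨ht, ht1⟩, ht0⟩ := ((hev.and h1).and self_mem_nhdsWithin).exists
  refine hS.eq_of_mem_interior hc hc' (z := AffineMap.lineMap b p t) ?_ ?_
  · refine (convex_convexHull ℝ _).segment_subset hbc (subset_convexHull ℝ _ hp) ?_
    rw [segment_eq_image_lineMap]
    exact ⟨t, ⟨(mem_Ioi.1 ht0).le, ht1.le⟩, rfl⟩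
  · exact interior_mono (convexHull_mono (by exact_mod_cast hHc')) (hH.mem_interior.2 ht)

/-- Cells are point sets, so one cell may cover `conv A` without using the point `o`. This is the
subdivision outside the component of the triangulation. -/
theorem singleton_erase [DecidableEq E] {o : E} (ho : o ∈ convexHull ℝ (A.erase o : Set E))
    (hspan : affineSpan ℝ (A.erase o : Set E) = ⊤) :
    IsPolyhedralSubdivision A {A.erase o} where
  subset σ hσ := by
    rw [Finset.mem_singleton.1 hσ]
    exact Finset.erase_subset _ _
  spanning σ hσ := by
    rw [Finset.mem_singleton.1 hσ]
    exact_mod_cast hspan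
  face σ hσ σ' hσ' := by
    rw [Finset.mem_singleton.1 hσ, Finset.mem_singleton.1 hσ', inter_self]
    exact ⟨IsExposed.refl _, IsExposed.refl _⟩
  agree σ hσ σ' hσ' := by
    rw [Finset.mem_singleton.1 hσ, Finset.mem_singleton.1 hσ']
  cover := by
    simp only [Finset.mem_singleton, iUnion_iUnion_eq_left]
    refine Subset.antisymm (convexHull_mono (by exact_mod_cast Finset.erase_subset _ _))
      (convexHull_min (fun x hx => ?_) (convex_convexHull ℝ _))
    by_cases h : x = o
    · rw [h]
      exact_mod_cast ho
    · exact subset_convexHull ℝ _ (Finset.mem_coe.2 (Finset.mem_erase.2 ⟨h, hx⟩))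

end IsPolyhedralSubdivision

/-- The cells `R` of a triangulation cannot be merged with anything: a subset of `A` that contains
a cell of `R` and another point, and which with a cell and a point beyond one of its facets
contains the neighbouring cell, is all of `A`. -/
def IsRigid [DecidableEq E] (A : Finset E) (R : Finset (Finset E)) : Prop :=
  ∀ F ∈ R, ∀ p ∈ A, p ∉ F → ∀ X ⊆ A, F ⊆ X → p ∈ X →
    (∀ G ∈ R, G ⊆ X → ∀ v ∈ G, ∀ w, w ∉ G → insert w (G.erase v) ∈ R → bary G v w < 0 →
      (∃ x ∈ X, bary G v x < 0) → w ∈ X) → X = A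

variable [DecidableEq E] {A : Finset E} {R S S' : Finset (Finset E)}

/-- A proper coarsening of a subdivision with rigid cells `R` has the cells `R`, too. -/
theorem IsRigid.subset_of_refines (hR : IsRigid A R) (hcell : ∀ F ∈ R, IsSimplexCell F)
    (hS : IsPolyhedralSubdivision A S) (hS' : IsPolyhedralSubdivision A S') (hne : S' ≠ {A})
    (hRS : R ⊆ S) (h : Refines S S') : R ⊆ S' := by
  intro F hF
  obtain ⟨c, hc, hFc⟩ := h F (hRS hF)
  by_cases hsub : c ⊆ F
  · exact Finset.Subset.antisymm hFc hsub ▸ hc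
  obtain ⟨p, hp, hpF⟩ := Finset.not_subset.1 hsub
  exfalso
  -- A cell `c` strictly larger than `F` is closed under the propagation by `mem_of_beyond`, so
  -- rigidity applies to `X = c`.
  have hcA : c = A := by
    refine hR F hF p (hS'.subset c hc hp) hpF c (hS'.subset c hc) hFc hp ?_
    rintro G hG hGc v hv w hw hH hneg ⟨x, hx, hxneg⟩
    obtain ⟨c', hc', hHc'⟩ := h _ (hRS hH)
    rw [hS'.mem_of_beyond hc hc' (hcell G hG) hGc hv (hcell _ hH) hHc' hneg hx hxneg]
    exact hHc' (Finset.mem_insert_self _ _)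
  subst hcA
  refine hne (Finset.eq_singleton_iff_unique_mem.2 ⟨hc, fun τ hτ => ?_⟩)
  exact hS'.eq_of_subset hτ hc (hS'.subset τ hτ)

/-- Rigid cells disconnect the Baues poset. -/
theorem not_preconnected_of_isRigid (hR : IsRigid A R) (hcell : ∀ F ∈ R, IsSimplexCell F)
    {T : Finset (Finset E)} (hT : IsPolyhedralSubdivision A T) (hTA : T ≠ {A}) (hRT : R ⊆ T)
    {F : Finset E} (hF : F ∈ R) {o : E} (hoF : o ∈ F)
    (ho : o ∈ convexHull ℝ (A.erase o : Set E))
    (hspan : affineSpan ℝ (A.erase o : Set E) = ⊤) :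
    ¬ (comparabilityGraph (BauesPoset A)).Preconnected := by
  intro hconn
  have hoA : o ∈ A := hT.subset F (hRT hF) hoF
  have hne : ({A.erase o} : Finset (Finset E)) ≠ {A} := fun h =>
    Finset.notMem_erase o A ((Finset.singleton_inj.1 h).symm ▸ hoA)
  let T' : BauesPoset A := ⟨T, hT, hTA⟩
  let S₀ : BauesPoset A := ⟨{A.erase o}, IsPolyhedralSubdivision.singleton_erase ho hspan, hne⟩
  have hclosed : ∀ U V : BauesPoset A, (comparabilityGraph (BauesPoset A)).Adj U V →
      R ⊆ U.1 → R ⊆ V.1 := by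
    intro U V hUV hRU
    rcases ((SimpleGraph.fromRel_adj _ _ _).1 hUV).2 with h | h
    · exact hR.subset_of_refines hcell U.2.1 V.2.1 V.2.2 hRU h
    · exact fun G hG => U.2.1.mem_of_refines V.2.1 h (hRU hG) (hcell G hG)
  have hwalk : ∀ U V : BauesPoset A, (comparabilityGraph (BauesPoset A)).Walk U V →
      R ⊆ U.1 → R ⊆ V.1 := by
    intro U V p
    induction p with
    | nil => exact id
    | cons hadj _ ih => exact fun h => ih (hclosed _ _ hadj h)
  obtain ⟨p⟩ := hconn T' S₀
  have hFmem := hwalk _ _ p hRT hF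
  rw [Finset.mem_singleton.1 hFmem] at hoF
  exact Finset.notMem_erase o A hoF

end Rigid

/-! ### The configuration and its computable certificates -/

namespace SeventeenPoints

/-- The coordinates of the seventeen points. -/
def coords : List (List Int) := [
  [-3, -1, 0, 0, -1, 0],
  [-3, 1, 0, 0, 1, 0],
  [3, 1, 0, 0, -1, 0],
  [3, -1, 0, 0, 1, 0],
  [1, -3, 0, 0, -1, -1],
  [-1, -3, 0, 0, 1, 1],
  [-1, 3, 0, 0, -1, -1],
  [1, 3, 0, 0, 1, 1],
  [0, 0, -3, 1, 0, -1],
  [0, 0, -3, -1, 0, 1],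
  [0, 0, 3, -1, 0, -1],
  [0, 0, 3, 1, 0, 1],
  [0, 0, -1, -3, 1, -1],
  [0, 0, 1, -3, -1, 1],
  [0, 0, 1, 3, 1, -1],
  [0, 0, -1, 3, -1, 1],
  [0, 0, 0, 0, 0, 0]]

/-- The cells of the triangulation; the binary digits of a number are the vertices of a cell. -/
def triang : List Nat := [
  4915, 5034, 5068, 5434, 5459, 5466, 5468, 5578, 7219, 7338, 7372, 9020, 9045, 9130, 9155,
  10803, 11324, 11349, 11459, 12604, 12629, 12739, 12851, 12970, 13004, 13075, 13084, 13098,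
  13106, 13112, 13123, 13132, 13194, 13250, 13256, 13372, 13397, 13507, 14387, 14506, 14540,
  15381, 15395, 15404, 15409, 15412, 15429, 15491, 15500, 15553, 15556, 17203, 17356, 17722,
  17747, 17754, 17756, 17866, 19507, 19626, 19660, 21779, 21788, 21802, 21810, 21816, 21827,
  21836, 21898, 21954, 21960, 33596, 33621, 33731, 35379, 35900, 35925, 36035, 41749, 41797,
  43539, 43555, 43564, 43569, 43572, 43660, 49468, 49493, 49603, 49715, 49868, 49955, 49964,
  49969, 49972, 50051, 50060, 50113, 50116, 50236, 50261, 50371, 51251, 51404, 51874, 51880,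
  52243, 52252, 52274, 52280, 52291, 52300, 52418, 52424, 69946, 69948, 69971, 69973, 69978,
  69980, 70083, 70090, 70714, 70716, 70739, 70741, 70746, 70748, 70851, 70858, 72723, 72725,
  72746, 72748, 72754, 72756, 72773, 72780, 72835, 72842, 72897, 72904, 74154, 74444, 74515,
  74540, 74546, 74548, 74572, 74627, 74658, 74664, 74689, 74696, 75946, 75980, 76332, 76338,
  76340, 76428, 76450, 76456, 78099, 78101, 78122, 78124, 78130, 78132, 78149, 78156, 78211,
  78218, 78273, 78280, 79891, 79893, 79914, 79916, 79922, 79924, 79941, 79948, 80003, 80010,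
  80065, 80072, 82234, 82236, 82259, 82261, 82266, 82268, 82346, 82371, 82378, 82707, 82732,
  82738, 82740, 82764, 82819, 82850, 82856, 82881, 82888, 83002, 83004, 83027, 83029, 83034,
  83036, 83139, 83146, 84138, 84642, 84648, 85034, 85130, 99020, 100556, 100908, 100914, 100916,
  101004, 101395, 101397, 101420, 101426, 101428, 101445, 101452, 101507, 101569, 101576, 106773,
  106821, 107027, 107139, 107201, 107204, 107281, 107284, 107329, 107332, 108563, 108565, 108613,
  108675, 108737, 108740, 109074, 109076, 109186, 109188, 114965, 115013, 115219, 115244, 115250,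
  115252, 115276, 115331, 115393, 115400, 115473, 115476, 115521, 115524, 115731, 115733, 115756,
  115762, 115764, 115781, 115788, 115843, 115905, 115912, 117282, 117288, 117378, 117384, 117794,
  117800, 117890, 117896]

/-- The cells of the triangulation that cannot be merged with anything else. -/
def rigid : List Nat := [
  72723, 72748, 72754, 72756, 72780, 72835, 72897, 72904, 74515, 74540, 74546, 74548, 74572,
  74627, 74689, 74696, 78099, 78124, 78130, 78132, 78156, 78211, 78273, 78280, 79891, 79916,
  79922, 79924, 79948, 80003, 80065, 80072, 82707, 82732, 82738, 82740, 82764, 82819, 82881,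
  82888, 101395, 101420, 101426, 101428, 101452, 101507, 101569, 101576, 115219, 115244, 115250,
  115252, 115276, 115331, 115393, 115400, 115731, 115756, 115762, 115764, 115788, 115843, 115905,
  115912]

def isPos : Int → Bool
  | .ofNat 0 => false
  | .ofNat (_ + 1) => true
  | .negSucc _ => false

def isNeg : Int → Bool
  | .ofNat _ => false
  | .negSucc _ => true

def isZero : Int → Bool
  | .ofNat 0 => true
  | _ => false

def dot : List Int → List Int → Int
  | a :: l, b :: m => Int.add (Int.mul a b) (dot l m)
  | _, _ => 0

def homog (i : Nat) : List Int := 1 :: coords.getD i []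

/-- The positions of the digits `1` in the binary expansion of a number. -/
def verts (m : Nat) : List Nat := (List.range 17).filter (Nat.testBit m)

/-- One row operation of fraction-free elimination, with pivot row `p :: r`. -/
def rowOp (prev p : Int) (r : List Int) : List Int → List Int
  | a :: s => List.zipWith (fun x y => Int.ediv (Int.sub (Int.mul p x) (Int.mul a y)) prev) s r
  | [] => []

/-- Moves the first row with a nonzero leading entry to the front. -/
def findPivot : List (List Int) → List (List Int) → Option (List Int × List (List Int))
  | _, [] => none
  | skipped, r :: rows =>
    match r with
    | 0 :: _ => findPivot (r :: skipped) rows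
    | _ => some (r, skipped ++ rows)

/-- Fraction-free Gauss-Jordan elimination. -/
def eliminate : Nat → Int → List (List Int) → List (List Int) → List (List Int) × Int
  | 0, prev, done, _ => (done, prev)
  | k + 1, prev, done, rows =>
    match findPivot [] rows with
    | some (p :: r, rest) =>
      eliminate k p (done.map (rowOp prev p r) ++ [r]) (rest.map (rowOp prev p r))
    | _ => (done, prev)

/-- For every vertex of a cell a linear form that vanishes at the other vertices. -/
def dualForms (vs : List Nat) : List (List Int) :=
  let pts := vs.map homog
  let M := (List.range 7).map fun j =>
    pts.map (fun v => v.getD j 0) ++ (List.range 7).map fun i => if i = j then 1 else 0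
  -- Reducing `[P | I]`, with the homogeneous points as columns of `P`, leaves `d` times the inverse
  -- of `P`, whose rows are dual to the points; the next line makes `d` positive. No property of the
  -- elimination is used later, since `isDual` tests its output.
  let R := eliminate 7 1 [] M
  if isPos R.2 then R.1 else R.1.map fun n => n.map Int.neg

/-- The vertices of a cell together with their linear forms. -/
def forms (m : Nat) : List (Nat × List Int) := (verts m).zip (dualForms (verts m))

def isDual (vs : List Nat) (v : Nat) (n : List Int) : Bool :=
  vs.all fun u => bif Nat.beq u v then isPos (dot n (homog u)) else isZero (dot n (homog u))

/-- The cells different from `m` that contain a facet of `m`. -/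
def nearCells (m : Nat) : List Nat :=
  -- `d` encodes the vertices of `m` missing from `t`, and `d &&& (d - 1) = 0` says that there is at
  -- most one.
  triang.filter fun t => let d := Nat.xor m (Nat.land m t)
    Nat.beq (Nat.land d (Nat.sub d 1)) 0 && !Nat.beq m t

/-- The facet of the cell `m` opposite to `v` is on the boundary or all other cells at this facet
are on its other side. -/
def facetOK (near : List Nat) (m v : Nat) (n : List Int) : Bool :=
  let w := Nat.xor m (Nat.pow 2 v)
  match near.filter fun t => Nat.beq (Nat.land t w) w with
  | [] => (List.range 17).all fun p => !isNeg (dot n (homog p))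
  | nb => nb.all fun t => (verts t).all fun u => Nat.testBit m u || isNeg (dot n (homog u))

/-- Seven times the value of a linear form at the barycentre of the cell `4915`. -/
def atCenter (n : List Int) : Int :=
  (verts 4915).foldr (fun i s => Int.add (dot n (homog i)) s) 0

/-- In the last clause, a form that is nonnegative on the cell but negative at the barycentre of the
cell `4915` shows that the cell misses this point. -/
def cellOK (m : Nat) : Bool :=
  let vs := verts m
  let ns := forms m
  let near := nearCells m
  Nat.beq vs.length 7 && Nat.beq ns.length 7 && Nat.blt m (Nat.pow 2 17) &&
  (ns.all fun x => isDual vs x.1 x.2 && facetOK near m x.1 x.2) &&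
    (Nat.beq m 4915 || ns.any fun x => isNeg (atCenter x.2))

/-- A triple `(m, B, t)` where `t` is a rigid cell that has a facet in common with the rigid cell
`m`, and the points in `B` are beyond this facet as seen from `m`. -/
def rules : List (Nat × Nat × Nat) := [
  (72723, 16808, 72754), (72723, 8900, 72835), (72723, 41512, 79891), (72723, 49476, 101395),
  (72748, 8785, 72756), (72748, 16834, 72780), (72748, 41602, 79916), (72748, 49425, 101420),
  (72754, 16780, 72756), (72754, 8773, 72723), (72754, 41537, 79922), (72754, 49544, 101426),
  (72756, 8771, 72754), (72756, 16778, 72748), (72756, 41537, 79924), (72756, 49544, 101428),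
  (72780, 16802, 72904), (72780, 8753, 72748), (72780, 41602, 79948), (72780, 49425, 101452),
  (72835, 8788, 72897), (72835, 16696, 72723), (72835, 41512, 80003), (72835, 49476, 101507),
  (72897, 8732, 72904), (72897, 16682, 72835), (72897, 41492, 80065), (72897, 49442, 101569),
  (72904, 16675, 72897), (72904, 8725, 72780), (72904, 41492, 80072), (72904, 49442, 101576),
  (74515, 5288, 74546), (74515, 35012, 74627), (74515, 21572, 78099), (74515, 51240, 82707),
  (74540, 34897, 74548), (74540, 5314, 74572), (74540, 21521, 78124), (74540, 51330, 82732),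
  (74546, 5260, 74548), (74546, 34885, 74515), (74546, 21640, 78130), (74546, 51265, 82738),
  (74548, 34883, 74546), (74548, 5258, 74540), (74548, 21640, 78132), (74548, 51265, 82740),
  (74572, 5282, 74696), (74572, 34865, 74540), (74572, 21521, 78156), (74572, 51330, 82764),
  (74627, 34900, 74689), (74627, 5176, 74515), (74627, 21572, 78211), (74627, 51240, 82819),
  (74689, 34844, 74696), (74689, 5162, 74627), (74689, 21538, 78273), (74689, 51220, 82881),
  (74696, 5155, 74689), (74696, 34837, 74572), (74696, 21538, 78280), (74696, 51220, 82888),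
  (78099, 33448, 78130), (78099, 17604, 78211), (78099, 19524, 79891), (78099, 35368, 74515),
  (78124, 17489, 78132), (78124, 33474, 78156), (78124, 19473, 79916), (78124, 35458, 74540),
  (78130, 33420, 78132), (78130, 17477, 78099), (78130, 19592, 79922), (78130, 35393, 74546),
  (78132, 17475, 78130), (78132, 33418, 78124), (78132, 19592, 79924), (78132, 35393, 74548),
  (78156, 33442, 78280), (78156, 17457, 78124), (78156, 19473, 79948), (78156, 35458, 74572),
  (78211, 17492, 78273), (78211, 33336, 78099), (78211, 19524, 80003), (78211, 35368, 74627),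
  (78273, 17436, 78280), (78273, 33322, 78211), (78273, 19490, 80065), (78273, 35348, 74689),
  (78280, 33315, 78273), (78280, 17429, 78156), (78280, 19490, 80072), (78280, 35348, 74696),
  (79891, 33448, 79922), (79891, 17604, 80003), (79891, 33576, 78099), (79891, 17732, 72723),
  (79916, 17489, 79924), (79916, 33474, 79948), (79916, 33666, 78124), (79916, 17681, 72748),
  (79922, 33420, 79924), (79922, 17477, 79891), (79922, 33601, 78130), (79922, 17800, 72754),
  (79924, 17475, 79922), (79924, 33418, 79916), (79924, 33601, 78132), (79924, 17800, 72756),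
  (79948, 33442, 80072), (79948, 17457, 79916), (79948, 33666, 78156), (79948, 17681, 72780),
  (80003, 17492, 80065), (80003, 33336, 79891), (80003, 33576, 78211), (80003, 17732, 72835),
  (80065, 17436, 80072), (80065, 33322, 80003), (80065, 33556, 78273), (80065, 17698, 72897),
  (80072, 33315, 80065), (80072, 17429, 79948), (80072, 33556, 78280), (80072, 17698, 72904),
  (82707, 5288, 82738), (82707, 35012, 82819), (82707, 43048, 115219), (82707, 13380, 74515),
  (82732, 34897, 82740), (82732, 5314, 82764), (82732, 43138, 115244), (82732, 13329, 74540),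
  (82738, 5260, 82740), (82738, 34885, 82707), (82738, 43073, 115250), (82738, 13448, 74546),
  (82740, 34883, 82738), (82740, 5258, 82732), (82740, 43073, 115252), (82740, 13448, 74548),
  (82764, 5282, 82888), (82764, 34865, 82732), (82764, 43138, 115276), (82764, 13329, 74572),
  (82819, 34900, 82881), (82819, 5176, 82707), (82819, 43048, 115331), (82819, 13380, 74627),
  (82881, 34844, 82888), (82881, 5162, 82819), (82881, 43028, 115393), (82881, 13346, 74689),
  (82888, 5155, 82881), (82888, 34837, 82764), (82888, 43028, 115400), (82888, 13346, 74696),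
  (101395, 16808, 101426), (101395, 8900, 101507), (101395, 20804, 115731), (101395, 12840,
  72723), (101420, 8785, 101428), (101420, 16834, 101452), (101420, 20753, 115756), (101420,
  12930, 72748), (101426, 16780, 101428), (101426, 8773, 101395), (101426, 20872, 115762),
  (101426, 12865, 72754), (101428, 8771, 101426), (101428, 16778, 101420), (101428, 20872,
  115764), (101428, 12865, 72756), (101452, 16802, 101576), (101452, 8753, 101420), (101452,
  20753, 115788), (101452, 12930, 72780), (101507, 8788, 101569), (101507, 16696, 101395),
  (101507, 20804, 115843), (101507, 12840, 72835), (101569, 8732, 101576), (101569, 16682,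
  101507), (101569, 20770, 115905), (101569, 12820, 72897), (101576, 16675, 101569), (101576,
  8725, 101452), (101576, 20770, 115912), (101576, 12820, 72904), (115219, 10408, 115250),
  (115219, 4548, 115331), (115219, 11304, 115731), (115219, 5444, 82707), (115244, 4433, 115252),
  (115244, 10434, 115276), (115244, 11394, 115756), (115244, 5393, 82732), (115250, 10380,
  115252), (115250, 4421, 115219), (115250, 11329, 115762), (115250, 5512, 82738), (115252, 4419,
  115250), (115252, 10378, 115244), (115252, 11329, 115764), (115252, 5512, 82740), (115276,
  10402, 115400), (115276, 4401, 115244), (115276, 11394, 115788), (115276, 5393, 82764), (115331,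
  4436, 115393), (115331, 10296, 115219), (115331, 11304, 115843), (115331, 5444, 82819), (115393,
  4380, 115400), (115393, 10282, 115331), (115393, 11284, 115905), (115393, 5410, 82881), (115400,
  10275, 115393), (115400, 4373, 115276), (115400, 11284, 115912), (115400, 5410, 82888), (115731,
  10408, 115762), (115731, 4548, 115843), (115731, 4932, 115219), (115731, 10792, 101395),
  (115756, 4433, 115764), (115756, 10434, 115788), (115756, 4881, 115244), (115756, 10882,
  101420), (115762, 10380, 115764), (115762, 4421, 115731), (115762, 5000, 115250), (115762,
  10817, 101426), (115764, 4419, 115762), (115764, 10378, 115756), (115764, 5000, 115252),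
  (115764, 10817, 101428), (115788, 10402, 115912), (115788, 4401, 115756), (115788, 4881,
  115276), (115788, 10882, 101452), (115843, 4436, 115905), (115843, 10296, 115731), (115843,
  4932, 115331), (115843, 10792, 101507), (115905, 4380, 115912), (115905, 10282, 115843),
  (115905, 4898, 115393), (115905, 10772, 101569), (115912, 10275, 115905), (115912, 4373,
  115788), (115912, 4898, 115400), (115912, 10772, 101576)]

def ruleOK (r : Nat × Nat × Nat) : Bool :=
  rigid.contains r.1 && rigid.contains r.2.2 && !Nat.beq r.1 r.2.2 &&
  Nat.blt r.2.1 (Nat.pow 2 17) &&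
  (forms r.1).any fun x =>
    let w := Nat.xor r.1 (Nat.pow 2 x.1)
    Nat.beq (Nat.land r.2.2 w) w &&
    (List.range 17).all fun p => !Nat.testBit r.2.1 p || isNeg (dot x.2 (homog p))

/-- Applying the rules in turn to the point set `X` leads to all seventeen points. -/
def fills (rs : List (Nat × Nat × Nat)) : Nat → Bool :=
  List.rec (motive := fun _ => Nat → Bool) (fun _ => false) (fun r _ ih X =>
    bif Nat.beq (Nat.land X r.1) r.1 then
      bif Nat.beq (Nat.land X r.2.1) 0 then ih X
      else bif Nat.beq (Nat.land X r.2.2) r.2.2 then ih X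
      else bif Nat.beq (Nat.lor X r.2.2) 131071 then true else ih (Nat.lor X r.2.2)
    else ih X) rs

/-- For each further point `p` the propagation has to reach all points. The rules are read in a
fixed order, and three passes suffice for every start. -/
def rigidOK (m : Nat) : Bool :=
  triang.contains m && (List.range 17).all fun p =>
    Nat.testBit m p || fills (rules ++ rules ++ rules) (Nat.lor m (Nat.pow 2 p))

set_option maxRecDepth 100000 in
theorem all_rigidOK : rigid.all rigidOK = true := by decide +kernel

set_option maxRecDepth 100000 in
theorem all_ruleOK : rules.all ruleOK = true := by decide +kernel

set_option maxRecDepth 100000 in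
theorem all_cellOK : triang.all cellOK = true := by decide +kernel

end SeventeenPoints

/-! ### Translating the certificates into geometry -/

namespace SeventeenPoints

theorem isPos_iff {a : ℤ} : isPos a = true ↔ 0 < a := by
  rcases a with (_ | n) | n <;> simp [isPos]

theorem isNeg_iff {a : ℤ} : isNeg a = true ↔ a < 0 := by
  rcases a with n | n <;> simp [isNeg]

theorem isZero_iff {a : ℤ} : isZero a = true ↔ a = 0 := by
  rcases a with (_ | n) | n
  · exact ⟨fun _ => rfl, fun _ => rfl⟩
  · simp only [isZero, Bool.false_eq_true, Int.ofNat_eq_natCast, false_iff]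
    omega
  · simp [isZero]

/-- The default `0` absorbs a difference between the two lengths. -/
theorem dot_eq_sum (n l : List ℤ) :
    dot n l = ∑ j ∈ Finset.range l.length, n.getD j 0 * l.getD j 0 := by
  induction l generalizing n with
  | nil => cases n <;> rfl
  | cons b l ih =>
    cases n with
    | nil => simp [dot]
    | cons a n =>
      rw [List.length_cons, Finset.sum_range_succ']
      simp only [List.getD_cons_succ, List.getD_cons_zero]
      rw [← ih, add_comm]
      rfl

theorem mem_verts {m i : ℕ} : i ∈ verts m ↔ i < 17 ∧ m.testBit i := by
  simp [verts]

theorem nodup_verts (m : ℕ) : (verts m).Nodup := List.nodup_range.filter _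

theorem land_eq_right_iff {s t : ℕ} :
    Nat.land t s = s ↔ ∀ i, s.testBit i → t.testBit i := by
  constructor
  · intro h i hi
    have := congrArg (Nat.testBit · i) h
    simp only [show Nat.land t s = t &&& s from rfl, Nat.testBit_land, hi, Bool.and_true] at this
    exact this
  · intro h
    refine Nat.eq_of_testBit_eq fun i => ?_
    have := h i
    rw [show Nat.land t s = t &&& s from rfl, Nat.testBit_land]
    cases hs : s.testBit i <;> simp_all

theorem testBit_facet {m v : ℕ} (hv : m.testBit v) (i : ℕ) :
    (Nat.xor m (Nat.pow 2 v)).testBit i ↔ m.testBit i ∧ i ≠ v := by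
  rw [show Nat.xor m (Nat.pow 2 v) = m ^^^ 2 ^ v from rfl, Nat.testBit_xor, Nat.testBit_two_pow]
  by_cases h : v = i
  · subst h
    simp [hv]
  · simp [h, Ne.symm h]

theorem lt_of_testBit {m i : ℕ} (hm : m < 2 ^ 17) (h : m.testBit i) : i < 17 := by
  by_contra hi
  rw [Nat.testBit_lt_two_pow (hm.trans_le (Nat.pow_le_pow_right two_pos (not_lt.1 hi)))] at h
  exact absurd h (by simp)

theorem testBit_all {i : ℕ} : Nat.testBit 131071 i ↔ i < 17 := by
  rw [show 131071 = 2 ^ 17 - 1 from rfl, Nat.testBit_two_pow_sub_one]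
  simp

/-- The points of the configuration. -/
noncomputable def point (i : ℕ) : EuclideanSpace ℝ (Fin 6) :=
  WithLp.toLp 2 fun j => (((coords.getD i []).getD j 0 : ℤ) : ℝ)

theorem length_coords : ∀ i < 17, (coords.getD i []).length = 6 := by decide

theorem eq_of_coords : ∀ i < 17, ∀ j < 17,
    (∀ k < 6, (coords.getD i []).getD k 0 = (coords.getD j []).getD k 0) → i = j := by decide

theorem point_injOn : InjOn point (Iio 17) := by
  intro i hi j hj h
  refine eq_of_coords i hi j hj fun k hk => ?_
  have := congrArg (fun x : EuclideanSpace ℝ (Fin 6) => x ⟨k, hk⟩) h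
  simpa only [point, Int.cast_inj] using this

/-- The affine function with given coefficients, the constant term first. -/
noncomputable def linearForm (n : List ℤ) : EuclideanSpace ℝ (Fin 6) →ᵃ[ℝ] ℝ :=
  (∑ j : Fin 6, ((n.getD (j + 1) 0 : ℤ) : ℝ) •
    (EuclideanSpace.proj j : EuclideanSpace ℝ (Fin 6) →L[ℝ] ℝ).toLinearMap).toAffineMap +
  AffineMap.const ℝ _ ((n.getD 0 0 : ℤ) : ℝ)

theorem linearForm_apply (n : List ℤ) (x : EuclideanSpace ℝ (Fin 6)) :
    linearForm n x = ∑ j : Fin 6, ((n.getD (j + 1) 0 : ℤ) : ℝ) * x j + ((n.getD 0 0 : ℤ) : ℝ) := by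
  simp [linearForm]

theorem linearForm_point (n : List ℤ) {i : ℕ} (hi : i < 17) :
    linearForm n (point i) = (dot n (homog i) : ℝ) := by
  rw [linearForm_apply, dot_eq_sum, homog, List.length_cons, length_coords i hi,
    Finset.sum_range_succ', Finset.sum_range]
  simp only [point, List.getD_cons_succ, List.getD_cons_zero]
  push_cast
  simp

open Classical in
/-- The set of points whose indices are the positions of the binary digits `1` of `m`. -/
noncomputable def cell (m : ℕ) : Finset (EuclideanSpace ℝ (Fin 6)) :=
  (verts m).toFinset.image point

theorem mem_cell {m : ℕ} {x : EuclideanSpace ℝ (Fin 6)} :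
    x ∈ cell m ↔ ∃ i < 17, m.testBit i ∧ point i = x := by
  simp only [cell, Finset.mem_image, List.mem_toFinset, mem_verts, and_assoc]

theorem point_mem_cell {m i : ℕ} (hi : i < 17) : point i ∈ cell m ↔ m.testBit i := by
  rw [mem_cell]
  constructor
  · rintro ⟨j, hj, hm, h⟩
    rwa [← point_injOn hj hi h]
  · exact fun h => ⟨i, hi, h, rfl⟩

theorem card_cell (m : ℕ) : (cell m).card = (verts m).length := by
  rw [cell, Finset.card_image_of_injOn, List.toFinset_card_of_nodup (nodup_verts m)]
  refine point_injOn.mono fun i hi => ?_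
  rw [Finset.mem_coe, List.mem_toFinset, mem_verts] at hi
  exact hi.1

theorem cell_subset_all (m : ℕ) : cell m ⊆ cell 131071 := by
  intro x hx
  obtain ⟨i, hi, _, rfl⟩ := mem_cell.1 hx
  exact (point_mem_cell hi).2 (testBit_all.2 hi)

theorem eq_of_cell_eq {m t : ℕ} (hm : m < 2 ^ 17) (ht : t < 2 ^ 17) (h : cell m = cell t) :
    m = t := by
  refine Nat.eq_of_testBit_eq fun i => ?_
  rw [Bool.eq_iff_iff]
  constructor
  · intro hi
    rwa [← point_mem_cell (lt_of_testBit hm hi), ← h, point_mem_cell (lt_of_testBit hm hi)]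
  · intro hi
    rwa [← point_mem_cell (lt_of_testBit ht hi), h, point_mem_cell (lt_of_testBit ht hi)]

open Classical in
noncomputable def cells (l : List ℕ) : Finset (Finset (EuclideanSpace ℝ (Fin 6))) :=
  (l.map cell).toFinset

theorem mem_cells {l : List ℕ} {σ : Finset (EuclideanSpace ℝ (Fin 6))} :
    σ ∈ cells l ↔ ∃ m ∈ l, cell m = σ := by
  simp [cells]

section Cell

variable {m : ℕ} (hm : m ∈ triang)

include hm

theorem cellOK_of_mem : cellOK m = true := List.all_eq_true.1 all_cellOK m hm

theorem length_verts : (verts m).length = 7 := by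
  have h := cellOK_of_mem hm
  simp only [cellOK, Bool.and_eq_true] at h
  exact Nat.eq_of_beq_eq_true h.1.1.1.1

theorem lt_of_mem_triang : m < 2 ^ 17 := by
  have h := cellOK_of_mem hm
  simp only [cellOK, Bool.and_eq_true] at h
  have := h.1.1.2
  rwa [Nat.blt_eq] at this

theorem map_fst_forms : (forms m).map Prod.fst = verts m := by
  have h := cellOK_of_mem hm
  simp only [cellOK, Bool.and_eq_true] at h
  have h7 := Nat.eq_of_beq_eq_true h.1.1.1.2
  have h7' := length_verts hm
  rw [forms, List.length_zip] at h7
  exact List.map_fst_zip (by omega)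

theorem mem_verts_of_mem_forms {x : ℕ × List ℤ} (hx : x ∈ forms m) : x.1 < 17 ∧ m.testBit x.1 := by
  rw [← mem_verts, ← map_fst_forms hm]
  exact List.mem_map_of_mem hx

theorem exists_mem_forms {v : ℕ} (hv : v < 17) (hmv : m.testBit v) : ∃ n, (v, n) ∈ forms m := by
  have : v ∈ (forms m).map Prod.fst := by
    rw [map_fst_forms hm]
    exact mem_verts.2 ⟨hv, hmv⟩
  obtain ⟨⟨_, n⟩, hx, rfl⟩ := List.mem_map.1 this
  exact ⟨n, hx⟩

theorem isDual_of_mem_forms {x : ℕ × List ℤ} (hx : x ∈ forms m) :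
    isDual (verts m) x.1 x.2 = true ∧ facetOK (nearCells m) m x.1 x.2 = true := by
  have h := cellOK_of_mem hm
  simp only [cellOK, Bool.and_eq_true] at h
  simpa only [Bool.and_eq_true] using List.all_eq_true.1 h.1.2 x hx

theorem exists_atCenter_neg (h4 : m ≠ 4915) : ∃ x ∈ forms m, atCenter x.2 < 0 := by
  have h := cellOK_of_mem hm
  simp only [cellOK, Bool.and_eq_true] at h
  rcases (Bool.or_eq_true _ _).mp h.2 with h | h
  · exact absurd (Nat.eq_of_beq_eq_true h) h4
  · obtain ⟨x, hx, hn⟩ := List.any_eq_true.1 h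
    exact ⟨x, hx, isNeg_iff.1 hn⟩

theorem dot_self_pos {v : ℕ} {n : List ℤ} (hx : (v, n) ∈ forms m) : 0 < dot n (homog v) := by
  have h := List.all_eq_true.1 (isDual_of_mem_forms hm hx).1 v
    (mem_verts.2 (mem_verts_of_mem_forms hm hx))
  simpa [isPos_iff] using h

theorem dot_of_ne {u v : ℕ} {n : List ℤ} (hx : (v, n) ∈ forms m) (hu : u < 17) (hmu : m.testBit u)
    (huv : u ≠ v) : dot n (homog u) = 0 := by
  have h := List.all_eq_true.1 (isDual_of_mem_forms hm hx).1 u (mem_verts.2 ⟨hu, hmu⟩)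
  have hb : Nat.beq u v = false := by
    rw [← Bool.not_eq_true]
    exact fun h => huv (Nat.eq_of_beq_eq_true h)
  simpa [isZero_iff, hb] using h

theorem linearForm_self_pos {v : ℕ} {n : List ℤ} (hx : (v, n) ∈ forms m) :
    0 < linearForm n (point v) := by
  rw [linearForm_point n (mem_verts_of_mem_forms hm hx).1]
  exact_mod_cast dot_self_pos hm hx

theorem linearForm_of_ne {v : ℕ} {n : List ℤ} (hx : (v, n) ∈ forms m) :
    ∀ u ∈ cell m, u ≠ point v → linearForm n u = 0 := by
  intro u hu huv
  obtain ⟨i, hi, hmi, rfl⟩ := mem_cell.1 hu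
  rw [linearForm_point n hi, dot_of_ne hm hx hi hmi fun h => huv (h ▸ rfl), Int.cast_zero]

theorem isSimplexCell_cell : IsSimplexCell (cell m) := by
  have h : ∀ x, ∃ f : EuclideanSpace ℝ (Fin 6) →ᵃ[ℝ] ℝ, x ∈ cell m →
      f x ≠ 0 ∧ ∀ u ∈ cell m, u ≠ x → f u = 0 := by
    intro x
    by_cases hx : x ∈ cell m
    · obtain ⟨v, hv, hmv, rfl⟩ := mem_cell.1 hx
      obtain ⟨n, hn⟩ := exists_mem_forms hm hv hmv
      exact ⟨linearForm n, fun _ => ⟨(linearForm_self_pos hm hn).ne', linearForm_of_ne hm hn⟩⟩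
    · exact ⟨0, fun h => absurd h hx⟩
  choose f hf using h
  refine IsSimplexCell.of_dual ?_ f (fun v hv => (hf v hv).1) fun v hv => (hf v hv).2
  rw [card_cell, length_verts hm]
  simp

/-- The integer form is a positive multiple of the barycentric coordinate, so sign tests on integers
decide sides of facets. -/
theorem bary_neg_iff {v : ℕ} {n : List ℤ} (hx : (v, n) ∈ forms m) (x : EuclideanSpace ℝ (Fin 6)) :
    bary (cell m) (point v) x < 0 ↔ linearForm n x < 0 := by
  have hv := mem_verts_of_mem_forms hm hx
  rw [(isSimplexCell_cell hm).affine_eq_mul ((point_mem_cell hv.1).2 hv.2)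
    (linearForm_of_ne hm hx) x]
  have hpos := linearForm_self_pos hm hx
  exact ⟨fun h => mul_neg_of_neg_of_pos h hpos, fun h => by_contra fun hn =>
    h.not_ge (mul_nonneg (not_lt.1 hn) hpos.le)⟩

omit hm

theorem facetOK_spec {near : List ℕ} {v : ℕ} {n : List ℤ} (h : facetOK near m v n = true) :
    (∀ t ∈ near, Nat.land t (Nat.xor m (Nat.pow 2 v)) = Nat.xor m (Nat.pow 2 v) →
      ∀ u < 17, t.testBit u → ¬ m.testBit u → dot n (homog u) < 0) ∧
    ((∃ t ∈ near, Nat.land t (Nat.xor m (Nat.pow 2 v)) = Nat.xor m (Nat.pow 2 v)) ∨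
      ∀ p < 17, ¬ dot n (homog p) < 0) := by
  have hmem : ∀ t, t ∈ near.filter (fun t => Nat.beq (Nat.land t (Nat.xor m (Nat.pow 2 v)))
      (Nat.xor m (Nat.pow 2 v))) ↔
      t ∈ near ∧ Nat.land t (Nat.xor m (Nat.pow 2 v)) = Nat.xor m (Nat.pow 2 v) := fun t => by
    rw [List.mem_filter, Nat.beq_eq]
  unfold facetOK at h
  dsimp only at h
  split at h
  · rename_i h0
    rw [h0] at hmem
    refine ⟨fun t ht hw => absurd ((hmem t).2 ⟨ht, hw⟩) List.not_mem_nil, Or.inr fun p hp hn => ?_⟩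
    have := List.all_eq_true.1 h p (List.mem_range.2 hp)
    rw [isNeg_iff.2 hn] at this
    exact absurd this (by simp)
  · rename_i h0
    refine ⟨fun t ht hw u hu htu hmu => ?_, Or.inl ?_⟩
    · have := List.all_eq_true.1 (List.all_eq_true.1 h t ((hmem t).2 ⟨ht, hw⟩)) u
        (mem_verts.2 ⟨hu, htu⟩)
      rw [Bool.or_eq_true] at this
      exact isNeg_iff.1 (this.resolve_left hmu)
    · obtain ⟨t, ht⟩ := List.exists_mem_of_ne_nil _ h0
      exact ⟨t, (hmem t).1 ht⟩

/-- The prefilter loses no neighbour: a cell containing the facet misses at most `v`, so the tested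
number is `0` or `2 ^ v`. -/
theorem mem_nearCells {t v : ℕ} (hmv : m.testBit v) (hne : m ≠ t) (ht : t ∈ triang)
    (h : Nat.land t (Nat.xor m (Nat.pow 2 v)) = Nat.xor m (Nat.pow 2 v)) : t ∈ nearCells m := by
  have hsub : ∀ i, m.testBit i → i ≠ v → t.testBit i := fun i hi hiv =>
    land_eq_right_iff.1 h i ((testBit_facet hmv i).2 ⟨hi, hiv⟩)
  have hd : Nat.xor m (Nat.land m t) = 0 ∨ Nat.xor m (Nat.land m t) = 2 ^ v := by
    have hbit : ∀ i, (Nat.xor m (Nat.land m t)).testBit i = (m.testBit i && !t.testBit i) := by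
      intro i
      rw [show Nat.xor m (Nat.land m t) = m ^^^ (m &&& t) from rfl, Nat.testBit_xor,
        Nat.testBit_land]
      cases m.testBit i <;> cases t.testBit i <;> rfl
    by_cases htv : t.testBit v
    · left
      refine Nat.eq_of_testBit_eq fun i => ?_
      rw [hbit]
      by_cases hiv : i = v
      · simp [hiv, htv]
      · cases hmi : m.testBit i
        · simp
        · simp [hsub i hmi hiv]
    · right
      refine Nat.eq_of_testBit_eq fun i => ?_
      rw [hbit, Nat.testBit_two_pow]
      by_cases hiv : i = v
      · simp [hiv, htv, hmv]
      · cases hmi : m.testBit i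
        · simp [Ne.symm hiv]
        · simp [hsub i hmi hiv, Ne.symm hiv]
  refine List.mem_filter.2 ⟨ht, ?_⟩
  dsimp only
  rw [Bool.and_eq_true]
  constructor
  · rcases hd with h | h <;> rw [h]
    · rfl
    · rw [show Nat.land (2 ^ v) (Nat.sub (2 ^ v) 1) = 2 ^ v &&& (2 ^ v - 1) from rfl,
        Nat.and_two_pow_sub_one_eq_mod, Nat.mod_self]
      rfl
  · rw [Bool.not_eq_true', ← Bool.not_eq_true]
    exact fun h => hne (Nat.eq_of_beq_eq_true h)

end Cell

end SeventeenPoints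

/-! ### The triangulation, its rigid cells and the conclusion -/

namespace SeventeenPoints

open Classical in
/-- A cell contains the facet of `cell m` opposite to `point v` if its set of digits does. -/
theorem facet_subset_iff {m t v : ℕ} (hm : m < 2 ^ 17) (hv : v < 17) (hmv : m.testBit v) :
    Nat.land t (Nat.xor m (Nat.pow 2 v)) = Nat.xor m (Nat.pow 2 v) ↔
      (cell m).erase (point v) ⊆ cell t := by
  rw [land_eq_right_iff]
  constructor
  · intro h x hx
    obtain ⟨hxv, hx⟩ := Finset.mem_erase.1 hx
    obtain ⟨i, hi, hmi, rfl⟩ := mem_cell.1 hx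
    exact (point_mem_cell hi).2 (h i ((testBit_facet hmv i).2 ⟨hmi, fun h => hxv (h ▸ rfl)⟩))
  · intro h i hi
    obtain ⟨hmi, hiv⟩ := (testBit_facet hmv i).1 hi
    have hi17 := lt_of_testBit hm hmi
    exact (point_mem_cell hi17).1 (h (Finset.mem_erase.2
      ⟨fun h => hiv (point_injOn hi17 hv h), (point_mem_cell hi17).2 hmi⟩))

-- All cells have seven vertices, so a different cell containing a facet adds exactly one new
-- vertex.
open Classical in
theorem exists_insert_eq {m t v : ℕ} (hm : m ∈ triang) (ht : t ∈ triang) (hne : m ≠ t)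
    (hv : v < 17) (hmv : m.testBit v)
    (h : Nat.land t (Nat.xor m (Nat.pow 2 v)) = Nat.xor m (Nat.pow 2 v)) :
    ∃ x ∉ cell m, insert x ((cell m).erase (point v)) = cell t := by
  have hsub := (facet_subset_iff (lt_of_mem_triang hm) hv hmv).1 h
  have hvm := (point_mem_cell hv).2 hmv
  have hcard : ((cell m).erase (point v)).card + 1 = (cell t).card := by
    rw [Finset.card_erase_add_one hvm, card_cell, card_cell, length_verts hm, length_verts ht]
  obtain ⟨x, hx, hxt⟩ := Finset.exists_eq_insert_iff.2 ⟨hsub, hcard⟩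
  refine ⟨x, fun hxm => hne ?_, hxt⟩
  have hxv : x = point v := by
    by_contra hxv
    exact hx (Finset.mem_erase.2 ⟨hxv, hxm⟩)
  rw [hxv, Finset.insert_erase hvm] at hxt
  exact eq_of_cell_eq (lt_of_mem_triang hm) (lt_of_mem_triang ht) hxt

open Classical in
theorem isPseudoManifold : IsPseudoManifold (cell 131071) (cells triang) where
  subset σ hσ := by
    obtain ⟨m, _, rfl⟩ := mem_cells.1 hσ
    exact cell_subset_all m
  cell σ hσ := by
    obtain ⟨m, hm, rfl⟩ := mem_cells.1 hσ
    exact isSimplexCell_cell hm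
  facet σ hσ x hx := by
    obtain ⟨m, hm, rfl⟩ := mem_cells.1 hσ
    obtain ⟨v, hv, hmv, rfl⟩ := mem_cell.1 hx
    obtain ⟨n, hn⟩ := exists_mem_forms hm hv hmv
    rcases (facetOK_spec (isDual_of_mem_forms hm hn).2).2 with ⟨t, ht, hw⟩ | h
    · right
      obtain ⟨ht, hne⟩ := List.mem_filter.1 ht
      have hne' : m ≠ t := by
        rintro rfl
        simp at hne
      obtain ⟨x, hx, hxt⟩ := exists_insert_eq hm ht hne' hv hmv hw
      exact ⟨x, hx, hxt ▸ mem_cells.2 ⟨t, ht, rfl⟩⟩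
    · left
      intro p hp
      obtain ⟨i, hi, _, rfl⟩ := mem_cell.1 hp
      rw [← not_lt, bary_neg_iff hm hn, linearForm_point n hi]
      exact_mod_cast h i hi
  opposite σ hσ x hx w hw hwT := by
    obtain ⟨m, hm, rfl⟩ := mem_cells.1 hσ
    obtain ⟨v, hv, hmv, rfl⟩ := mem_cell.1 hx
    obtain ⟨n, hn⟩ := exists_mem_forms hm hv hmv
    obtain ⟨t, ht, heq⟩ := mem_cells.1 hwT
    have hwt : w ∈ cell t := heq ▸ Finset.mem_insert_self _ _
    obtain ⟨u, hu, htu, rfl⟩ := mem_cell.1 hwt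
    rw [point_mem_cell hu] at hw
    have hland := (facet_subset_iff (t := t) (lt_of_mem_triang hm) hv hmv).2
      (heq ▸ Finset.subset_insert _ _)
    have hne : m ≠ t := by
      rintro rfl
      exact hw htu
    have := (facetOK_spec (isDual_of_mem_forms hm hn).2).1 t
      (mem_nearCells hmv hne ht hland) hland u hu htu hw
    rw [bary_neg_iff hm hn, linearForm_point n hu]
    exact_mod_cast this

/-- The barycentre of the cell `4915`. -/
noncomputable def center : EuclideanSpace ℝ (Fin 6) :=
  ∑ i ∈ (verts 4915).toFinset, (1 / 7 : ℝ) • point i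

theorem card_verts_4915 : (verts 4915).toFinset.card = 7 := by decide

theorem sum_weights : ∑ _i ∈ (verts 4915).toFinset, (1 / 7 : ℝ) = 1 := by
  rw [Finset.sum_const, card_verts_4915]
  norm_num

theorem atCenter_eq (n : List ℤ) :
    atCenter n = ∑ i ∈ (verts 4915).toFinset, dot n (homog i) := by
  rw [List.sum_toFinset _ (nodup_verts _), atCenter]
  induction verts 4915 with
  | nil => rfl
  | cons i l ih =>
    rw [List.foldr_cons, ih, List.map_cons, List.sum_cons]
    rfl

theorem linearForm_center (n : List ℤ) : linearForm n center = atCenter n / 7 := by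
  rw [center, affine_sum_smul _ _ _ _ sum_weights, atCenter_eq, Int.cast_sum, Finset.sum_div]
  refine Finset.sum_congr rfl fun i hi => ?_
  rw [linearForm_point n (mem_verts.1 (List.mem_toFinset.1 hi)).1]
  ring

/-- Each other cell lies in a half-space given by one of its own dual forms that excludes the
barycentre. -/
theorem simple_center : IsPseudoManifold.Simple (cells triang) (cell 4915) center where
  mem := mem_cells.2 ⟨4915, by decide, rfl⟩
  covers := by
    refine (convex_convexHull ℝ _).sum_mem (fun _ _ => by norm_num) sum_weights fun i hi => ?_
    obtain ⟨hi, hmi⟩ := mem_verts.1 (List.mem_toFinset.1 hi)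
    exact subset_convexHull ℝ _ (Finset.mem_coe.2 ((point_mem_cell hi).2 hmi))
  once τ hτ hne hq := by
    obtain ⟨m, hm, rfl⟩ := mem_cells.1 hτ
    obtain ⟨⟨v, n⟩, hn, hneg⟩ := exists_atCenter_neg hm fun h => hne (h ▸ rfl)
    have hsub : (cell m : Set (EuclideanSpace ℝ (Fin 6))) ⊆ linearForm n ⁻¹' Ici 0 := by
      intro u hu
      by_cases huv : u = point v
      · rw [huv]
        exact (linearForm_self_pos hm hn).le
      · exact (linearForm_of_ne hm hn u hu huv).ge
    have h0 : 0 ≤ linearForm n center :=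
      convexHull_min hsub ((convex_Ici 0).affine_preimage _) hq
    rw [linearForm_center] at h0
    have hneg' : (atCenter n : ℝ) < 0 := by exact_mod_cast hneg
    linarith

theorem isPolyhedralSubdivision : IsPolyhedralSubdivision (cell 131071) (cells triang) := by
  classical
  exact isPseudoManifold.isPolyhedralSubdivision simple_center

theorem mem_triang_of_mem_rigid {m : ℕ} (hm : m ∈ rigid) : m ∈ triang := by
  have h := List.all_eq_true.1 all_rigidOK m hm
  rw [rigidOK, Bool.and_eq_true] at h
  simpa using h.1

theorem fills_of_mem_rigid {m p : ℕ} (hm : m ∈ rigid) (hp : p < 17) (hmp : ¬ m.testBit p) :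
    fills (rules ++ rules ++ rules) (Nat.lor m (Nat.pow 2 p)) = true := by
  have h := List.all_eq_true.1 all_rigidOK m hm
  rw [rigidOK, Bool.and_eq_true] at h
  have := List.all_eq_true.1 h.2 p (List.mem_range.2 hp)
  rw [Bool.or_eq_true] at this
  exact this.resolve_left hmp

theorem fills_cons (r : ℕ × ℕ × ℕ) (rs : List (ℕ × ℕ × ℕ)) (X : ℕ) :
    fills (r :: rs) X =
      bif Nat.beq (Nat.land X r.1) r.1 then
        bif Nat.beq (Nat.land X r.2.1) 0 then fills rs X
        else bif Nat.beq (Nat.land X r.2.2) r.2.2 then fills rs X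
        else bif Nat.beq (Nat.lor X r.2.2) 131071 then true else fills rs (Nat.lor X r.2.2)
      else fills rs X := rfl

theorem testBit_lor {a b i : ℕ} : (Nat.lor a b).testBit i ↔ a.testBit i ∨ b.testBit i := by
  rw [show Nat.lor a b = a ||| b from rfl, Nat.testBit_or, Bool.or_eq_true]

/-- A property of points that holds on the set `X` and is preserved by the rules holds at all
points. -/
theorem forall_of_fills {P : ℕ → Prop} {rs : List (ℕ × ℕ × ℕ)}
    (hrs : ∀ r ∈ rs, (∀ i < 17, r.1.testBit i → P i) →
      (∃ i, r.2.1.testBit i ∧ P i) → ∀ i < 17, r.2.2.testBit i → P i)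
    (hB : ∀ r ∈ rs, r.2.1 < 2 ^ 17)
    {X : ℕ} (hX : ∀ i < 17, X.testBit i → P i) (h : fills rs X = true) : ∀ i < 17, P i := by
  induction rs generalizing X with
  | nil => exact absurd h (by simp [fills])
  | cons r rs ih =>
    have ih' := @ih (fun r hr => hrs r (List.mem_cons_of_mem _ hr))
      fun r hr => hB r (List.mem_cons_of_mem _ hr)
    rw [fills_cons] at h
    cases h1 : Nat.beq (Nat.land X r.1) r.1 with
    | false => exact ih' hX (by simpa only [h1, cond_false] using h)
    | true =>
      cases h2 : Nat.beq (Nat.land X r.2.1) 0 with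
      | true => exact ih' hX (by simpa only [h1, h2, cond_true] using h)
      | false =>
        have hY : ∀ i < 17, (Nat.lor X r.2.2).testBit i → P i := by
          have h1' := land_eq_right_iff.1 (Nat.eq_of_beq_eq_true h1)
          have h2' : X &&& r.2.1 ≠ 0 := fun h0 => by
            rw [show Nat.land X r.2.1 = X &&& r.2.1 from rfl, h0] at h2
            exact absurd h2 (by decide)
          obtain ⟨j, hj⟩ := Nat.exists_testBit_of_ne_zero h2'
          rw [Nat.testBit_land, Bool.and_eq_true] at hj
          have hj17 := lt_of_testBit (hB r List.mem_cons_self) hj.2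
          intro i hi hiY
          rcases testBit_lor.1 hiY with hiX | hit
          · exact hX i hi hiX
          · exact hrs r List.mem_cons_self (fun i hi hir => hX i hi (h1' i hir))
              ⟨j, hj.2, hX j hj17 hj.1⟩ i hi hit
        cases h3 : Nat.beq (Nat.land X r.2.2) r.2.2 with
        | true => exact ih' hX (by simpa only [h1, h2, h3, cond_true, cond_false] using h)
        | false =>
          cases h4 : Nat.beq (Nat.lor X r.2.2) 131071 with
          | true =>
            intro i hi
            rw [Nat.eq_of_beq_eq_true h4] at hY
            exact hY i hi (testBit_all.2 hi)
          | false =>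
            exact ih' hY (by simpa only [h1, h2, h3, h4, cond_true, cond_false] using h)

theorem rule_spec {r : ℕ × ℕ × ℕ} (hr : r ∈ rules) :
    r.1 ∈ rigid ∧ r.2.2 ∈ rigid ∧ r.1 ≠ r.2.2 ∧ r.2.1 < 2 ^ 17 ∧
      ∃ v n, (v, n) ∈ forms r.1 ∧
        Nat.land r.2.2 (Nat.xor r.1 (Nat.pow 2 v)) = Nat.xor r.1 (Nat.pow 2 v) ∧
        ∀ p < 17, r.2.1.testBit p → dot n (homog p) < 0 := by
  have h := List.all_eq_true.1 all_ruleOK r hr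
  simp only [ruleOK, Bool.and_eq_true, List.contains_iff_mem] at h
  obtain ⟨⟨⟨⟨h1, h2⟩, h3⟩, h4⟩, h5⟩ := h
  obtain ⟨⟨v, n⟩, hn, h⟩ := List.any_eq_true.1 h5
  rw [Bool.and_eq_true] at h
  refine ⟨h1, h2, ?_, by rwa [Nat.blt_eq] at h4, v, n, hn, Nat.eq_of_beq_eq_true h.1, ?_⟩
  · intro h0
    rw [h0] at h3
    simp at h3
  · intro p hp hB
    have := List.all_eq_true.1 h.2 p (List.mem_range.2 hp)
    rw [hB] at this
    exact isNeg_iff.1 (by simpa using this)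

-- Each rule is an instance of the closure hypothesis on `X`, so the certified deductions of `fills`
-- take place inside `X`.
open Classical in
theorem isRigid : IsRigid (cell 131071) (cells rigid) := by
  intro F hF p hp hpF X hXA hFX hpX hclosed
  obtain ⟨m, hm, rfl⟩ := mem_cells.1 hF
  obtain ⟨k, hk, _, rfl⟩ := mem_cell.1 hp
  rw [point_mem_cell hk] at hpF
  have hrule : ∀ r ∈ rules, (∀ i < 17, r.1.testBit i → point i ∈ X) →
      (∃ i, r.2.1.testBit i ∧ point i ∈ X) → ∀ i < 17, r.2.2.testBit i → point i ∈ X := by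
    rintro ⟨g, B, t⟩ hr hg ⟨j, hjB, hjX⟩ i hi hit
    obtain ⟨hgR, htR, hne, hB, v, n, hn, hland, hneg⟩ := rule_spec hr
    dsimp only at *
    have hgT := mem_triang_of_mem_rigid hgR
    obtain ⟨hv, hgv⟩ := mem_verts_of_mem_forms hgT hn
    obtain ⟨w, hw, hwt⟩ := exists_insert_eq hgT (mem_triang_of_mem_rigid htR) hne hv hgv hland
    have hgX : cell g ⊆ X := fun x hx => by
      obtain ⟨i, hi, hgi, rfl⟩ := mem_cell.1 hx
      exact hg i hi hgi
    have htcell : cell t ∈ cells rigid := mem_cells.2 ⟨t, htR, rfl⟩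
    have hj17 := lt_of_testBit hB hjB
    have hside : linearForm n (point j) < 0 := by
      rw [linearForm_point n hj17]
      exact_mod_cast hneg j hj17 hjB
    have hjneg : bary (cell g) (point v) (point j) < 0 := (bary_neg_iff hgT hn _).2 hside
    have hopp := isPseudoManifold.opposite (cell g) (mem_cells.2 ⟨g, hgT, rfl⟩) (point v)
      ((point_mem_cell hv).2 hgv) w hw
      (hwt ▸ mem_cells.2 ⟨t, mem_triang_of_mem_rigid htR, rfl⟩)
    have hwX : w ∈ X := hclosed (cell g) (mem_cells.2 ⟨g, hgR, rfl⟩) hgX (point v)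
      ((point_mem_cell hv).2 hgv) w hw (hwt ▸ htcell) hopp ⟨point j, hjX, hjneg⟩
    have hit' := (point_mem_cell hi).2 hit
    rw [← hwt, Finset.mem_insert] at hit'
    rcases hit' with h | h
    · rwa [h]
    · exact hgX (Finset.mem_of_mem_erase h)
  have hall : ∀ i < 17, point i ∈ X := by
    refine forall_of_fills (P := fun i => point i ∈ X) (rs := rules ++ rules ++ rules)
      (fun r hr => hrule r (by simpa [or_assoc] using hr))
      (fun r hr => (rule_spec (r := r) (by simpa [or_assoc] using hr)).2.2.2.1)
      ?_ (fills_of_mem_rigid hm hk hpF)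
    intro i hi him
    rcases testBit_lor.1 him with h | h
    · exact hFX ((point_mem_cell hi).2 h)
    · rw [show Nat.pow 2 k = 2 ^ k from rfl, Nat.testBit_two_pow, decide_eq_true_eq] at h
      rwa [← h]
  refine Finset.Subset.antisymm hXA fun x hx => ?_
  obtain ⟨i, hi, _, rfl⟩ := mem_cell.1 hx
  exact hall i hi

theorem card_all : (cell 131071).card = 17 := by
  rw [card_cell]
  rfl

open Classical in
theorem origin_mem_convexHull :
    point 16 ∈ convexHull ℝ ((cell 131071).erase (point 16) : Set (EuclideanSpace ℝ (Fin 6))) := by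
  -- The first four points sum to zero, so the origin is their barycentre.
  have hsum : ∑ i ∈ Finset.range 4, (1 / 4 : ℝ) • point i = point 16 := by
    ext j
    fin_cases j <;> simp [Finset.sum_range_succ, point, coords]
  rw [← hsum]
  refine (convex_convexHull ℝ _).sum_mem (fun _ _ => by norm_num) (by simp) fun i hi => ?_
  rw [hsum]
  have hi' : i < 4 := Finset.mem_range.1 hi
  have hi17 : i < 17 := by omega
  refine subset_convexHull ℝ _ (Finset.mem_coe.2 (Finset.mem_erase.2 ⟨fun h => ?_,
    (point_mem_cell hi17).2 (testBit_all.2 hi17)⟩))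
  have := point_injOn hi17 (show 16 < 17 by norm_num) h
  omega

open Classical in
theorem affineSpan_erase :
    affineSpan ℝ ((cell 131071).erase (point 16) : Set (EuclideanSpace ℝ (Fin 6))) = ⊤ := by
  refine top_unique ?_
  rw [← (isSimplexCell_cell (m := 4915) (by decide)).2]
  refine affineSpan_mono ℝ (Finset.coe_subset.2 (Finset.subset_erase.2 ⟨cell_subset_all _, ?_⟩))
  rw [point_mem_cell (by norm_num)]
  decide

/-- Any rigid cell with the origin as a vertex would do; `72723` is one. The triangulation is not
trivial because its cell `4915` has only seven points. -/
theorem not_preconnected : ¬ (comparabilityGraph (BauesPoset (cell 131071))).Preconnected := by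
  classical
  have hm : 72723 ∈ rigid := by decide
  refine not_preconnected_of_isRigid isRigid (fun F hF => ?_) isPolyhedralSubdivision ?_ ?_
    (mem_cells.2 ⟨72723, hm, rfl⟩) ((point_mem_cell (i := 16) (by norm_num)).2 (by decide))
    origin_mem_convexHull affineSpan_erase
  · obtain ⟨m, hm, rfl⟩ := mem_cells.1 hF
    exact isSimplexCell_cell (mem_triang_of_mem_rigid hm)
  · intro h
    have h4 : cell 4915 ∈ cells triang := mem_cells.2 ⟨4915, by decide, rfl⟩
    rw [h, Finset.mem_singleton] at h4
    have := congrArg Finset.card h4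
    rw [card_all, card_cell, length_verts (by decide)] at this
    omega
  · intro σ hσ
    obtain ⟨m, hm, rfl⟩ := mem_cells.1 hσ
    exact mem_cells.2 ⟨m, mem_triang_of_mem_rigid hm, rfl⟩

end SeventeenPoints

theorem mainTheorem2 :
    ∃ A : Finset (EuclideanSpace ℝ (Fin 6)),
      affineSpan ℝ (A : Set (EuclideanSpace ℝ (Fin 6))) = ⊤ ∧
      9 ≤ A.card ∧ A.card ≤ 17 ∧
      ¬ (comparabilityGraph (BauesPoset A)).Preconnected := by
  classical
  refine ⟨SeventeenPoints.cell 131071, top_unique ?_, ?_, ?_, SeventeenPoints.not_preconnected⟩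
  · rw [← SeventeenPoints.affineSpan_erase]
    exact affineSpan_mono ℝ (Finset.coe_subset.2 (Finset.erase_subset _ _))
  · rw [SeventeenPoints.card_all]
    norm_num
  · rw [SeventeenPoints.card_all]
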